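/- For a finite alphabet $A$, let $A^*$ be the set of finite words over $A$ and write $u\sqsubseteq v$ if $u$ is a (scattered) subword of $v$, i.e. $u=a_1\cdots a_n$ with $a_i\in A$ and $v=v_0a_1v_1\cdots a_nv_n$ for some $v_0,\dots,v_n\in A^*$. The basic logic $\mathrm{FO}(A^*,\sqsubseteq)$ is the first-order logic with variables ranging over $A^*$, the single binary predicate symbol $\sqsubseteq$, and every word $u\in A^*$ as a constant symbol denoting itself; formulas are built from the atomic formulas $s\sqsubseteq t$ ($s$, $t$ variables or constants) by $\neg,\wedge,\exists,\forall$ (other connectives and equality being abbreviations). The fragments $\Sigma_n$ and $\Pi_n$ ($n\ge 0$) are defined inductively, without requiring prenex form: atomic formulas are in all $\Sigma_n$ and $\Pi_n$; $\neg\varphi\in\Sigma_n$ iff $\varphi\in\Pi_n$, and $\neg\varphi\in\Pi_n$ iff $\varphi\in\Sigma_n$; a conjunction is in $\Sigma_n$ (resp. $\Pi_n$) iff both conjuncts are; $\exists x\,\varphi\in\Sigma_n$ iff $n\ge 1$ and $\varphi\in\Sigma_n$, and $\exists x\,\varphi\in\Pi_n$ iff $n\ge 2$ and $\varphi\in\Sigma_{n-1}$;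 $\forall x\,\varphi\in\Pi_n$ iff $n\ge 1$ and $\varphi\in\Pi_n$, and $\forall x\,\varphi\in\Sigma_n$ iff $n\ge 2$ and $\varphi\in\Pi_{n-1}$. The fragment $\mathrm{FO}^n$ consists of the formulas that use at most $n$ distinct variables, free or bound, each possibly many times. The truth problem asks, given a finite alphabet $A$ and a sentence $\varphi$ of the basic logic over $A$, whether $\varphi$ is true in $(A^*,\sqsubseteq)$. **Theorem (Undecidability).** The truth problem for the basic logic $\mathrm{FO}(A^*,\sqsubseteq)$ is undecidable, and it remains undecidable when restricted to sentences $\varphi$ in $\Sigma_2\cap\mathrm{FO}^3$. In the latter case this means: no algorithm, given any finite alphabet $A$ and any sentence $\varphi\in\Sigma_2\cap\mathrm{FO}^3$ over $A$, always halts and correctly answers whether $\varphi$ is true in $(A^*,\sqsubseteq)$. -/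

import Mathlib

namespace SubwordLogic

/-- Terms of the basic logic over the alphabet `A`: variables (named by natural numbers)
and one constant symbol for every word over `A`. -/
inductive Term (A : Type) : Type where
  | var (x : ℕ) : Term A
  | const (w : List A) : Term A

/-- First-order formulas of the basic logic over the alphabet `A`.  The only predicate symbol
is the subword relation; quantifiers bind named variables, which may be reused.
The other connectives and equality are abbreviations. -/
inductive Formula (A : Type) : Type where
  | sub (s t : Term A) : Formula A
  | neg (φ : Formula A) : Formula A
  | and (φ ψ : Formula A) : Formula A
  | ex (x : ℕ) (φ : Formula A) : Formula A
  | all (x : ℕ) (φ : Formula A) : Formula A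

namespace Term

variable {A : Type}

/-- The word denoted by a term under a valuation of the variables. -/
def eval (v : ℕ → List A) : Term A → List A
  | var x => v x
  | const w => w

/-- The variables of a term. -/
def vars : Term A → Finset ℕ
  | var x => {x}
  | const _ => ∅

/-- Code of a term over the alphabet `Fin k`. -/
def code {k : ℕ} : Term (Fin k) → ℕ
  | var x => Nat.pair 0 x
  | const w => Nat.pair 1 (Encodable.encode (w.map Fin.val))

theorem code_injective {k : ℕ} : Function.Injective (code (k := k)) := by
  intro s t h
  cases s <;> cases t <;> simp only [code, Nat.pair_eq_pair] at h
  · rw [h.2]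
  · exact absurd h.1 (by decide)
  · exact absurd h.1 (by decide)
  · rw [List.map_injective_iff.2 Fin.val_injective (Encodable.encode_injective h.2)]

end Term

namespace Formula

variable {A : Type}

/-- Satisfaction in the structure of all words over `A` with the subword ordering
(`List.Sublist`, the scattered-subsequence relation). -/
def Sat : (ℕ → List A) → Formula A → Prop
  | v, sub s t => (s.eval v).Sublist (t.eval v)
  | v, neg φ => ¬ Sat v φ
  | v, and φ ψ => Sat v φ ∧ Sat v ψ
  | v, ex x φ => ∃ w : List A, Sat (Function.update v x w) φ
  | v, all x φ => ∀ w : List A, Sat (Function.update v x w) φ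

/-- Truth in the structure; for a sentence the valuation is irrelevant. -/
def IsTrue (φ : Formula A) : Prop := ∀ v : ℕ → List A, Sat v φ

/-- The set of free variables. -/
def freeVars : Formula A → Finset ℕ
  | sub s t => s.vars ∪ t.vars
  | neg φ => φ.freeVars
  | and φ ψ => φ.freeVars ∪ ψ.freeVars
  | ex x φ => φ.freeVars.erase x
  | all x φ => φ.freeVars.erase x

/-- A sentence is a formula without free variables. -/
def IsSentence (φ : Formula A) : Prop := φ.freeVars = ∅

/-- The set of all variables used in a formula, free or bound. -/
def vars : Formula A → Finset ℕ
  | sub s t => s.vars ∪ t.vars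
  | neg φ => φ.vars
  | and φ ψ => φ.vars ∪ ψ.vars
  | ex x φ => insert x φ.vars
  | all x φ => insert x φ.vars

/-- The fragment `FO^n`: at most `n` distinct variables, each possibly used many times. -/
def IsFO (n : ℕ) (φ : Formula A) : Prop := φ.vars.card ≤ n

mutual

/-- The fragment `Σ_n` (formulas need not be prenex).  A universally quantified formula is in
`Σ_n` iff it is in `Π_(n-1)`, and no quantifier is allowed in `Σ_0` and `Π_0`. -/
def IsSigma : Formula A → ℕ → Prop
  | sub _ _, _ => True
  | neg φ, n => IsPi φ n
  | and φ ψ, n => IsSigma φ n ∧ IsSigma ψ n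
  | ex _ φ, n => 1 ≤ n ∧ IsSigma φ n
  | all _ φ, n => 2 ≤ n ∧ IsPi φ (n - 1)

/-- The fragment `Π_n`, dual to `Σ_n`. -/
def IsPi : Formula A → ℕ → Prop
  | sub _ _, _ => True
  | neg φ, n => IsSigma φ n
  | and φ ψ, n => IsPi φ n ∧ IsPi ψ n
  | ex _ φ, n => 2 ≤ n ∧ IsSigma φ (n - 1)
  | all _ φ, n => 1 ≤ n ∧ IsPi φ n

end

/-- Code of a formula over the alphabet `Fin k`, by structural recursion. -/
def code {k : ℕ} : Formula (Fin k) → ℕ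
  | sub s t => Nat.pair 0 (Nat.pair s.code t.code)
  | neg φ => Nat.pair 1 φ.code
  | and φ ψ => Nat.pair 2 (Nat.pair φ.code ψ.code)
  | ex x φ => Nat.pair 3 (Nat.pair x φ.code)
  | all x φ => Nat.pair 4 (Nat.pair x φ.code)

theorem code_injective {k : ℕ} : Function.Injective (code (k := k)) := by
  intro φ
  induction φ with
  | sub s t =>
    intro χ h
    cases χ <;> simp [code, Nat.pair_eq_pair] at h
    rw [Term.code_injective h.1, Term.code_injective h.2]
  | neg φ ih =>
    intro χ h
    cases χ <;> simp [code, Nat.pair_eq_pair] at h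
    rw [ih h]
  | and φ ψ ih₁ ih₂ =>
    intro χ h
    cases χ <;> simp [code, Nat.pair_eq_pair] at h
    rw [ih₁ h.1, ih₂ h.2]
  | ex x φ ih =>
    intro χ h
    cases χ <;> simp [code, Nat.pair_eq_pair] at h
    rw [h.1, ih h.2]
  | all x φ ih =>
    intro χ h
    cases χ <;> simp [code, Nat.pair_eq_pair] at h
    rw [h.1, ih h.2]

end Formula

/-- An instance of the truth problem: a finite alphabet, given by its number `k` of letters
(the letters being `0, …, k - 1`), and a formula over this alphabet. -/
structure Instance : Type where
  k : ℕ
  formula : Formula (Fin k)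

/-- Code of an instance as a natural number, the input of an algorithm. -/
def Instance.code (I : Instance) : ℕ := Nat.pair I.k I.formula.code

theorem Instance.code_injective : Function.Injective Instance.code := by
  rintro ⟨k, φ⟩ ⟨l, ψ⟩ h
  simp only [Instance.code, Nat.pair_eq_pair] at h
  obtain ⟨rfl, h⟩ := h
  rw [Formula.code_injective h]

/-- The truth problem restricted to the instances in `S` is decidable: some algorithm (partial
recursive function), run on the code of any instance in `S`, halts and answers correctly
whether the formula is true.  Nothing is required of its behaviour on other inputs. -/
def TruthProblemDecidableOn (S : Set Instance) : Prop :=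
  ∃ d : ℕ →. Bool, Partrec d ∧
    ∀ I ∈ S, ∃ b ∈ d I.code, (b = true ↔ I.formula.IsTrue)

end SubwordLogic

/-!
The halting problem of a fixed Turing machine, on the inputs `a bᵐ`, is undecidable
(`Turing.TM0.exists_not_computablePred_halts`). The machine is simulated by a fixed finite semi-Thue
system, and so it halts on `a bᵐ` iff a word `u bᵐ v`, with fixed `u` and `v`, rewrites to a fixed
final word (`TMRewriting.eval_dom_iff`). A derivation can be written down as a sequence of moves from
a finite set, in the manner of Post's correspondence problem: each move consumes one word and produces
another, and the derivation is correct iff the concatenation of all words produced is the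
concatenation of all words consumed, provided that the moves occur in the right order, which is a
condition on the subsequences of length two (`Move.exists_transcript_iff`). The number `m` is the
number of occurrences of the move `load`.

A sequence of moves `r₁ ⋯ rₙ`, together with the words `p r₁, …, p rₙ` that they produce, is
represented by the word `x = s r₁ (p r₁) s r₂ (p r₂) ⋯ s rₙ (p rₙ)`, where `s` is a separator. Let `y`
represent a sequence of moves together with the words consumed. The two sequences are the same, and
the words produced and consumed agree, iff `x` and `y` have the same subwords over the moves and the
same subwords over the symbols (`SubwordLogic.Letter.forall_sublist_iff`). Order conditions, and the presence and
the number of occurrences of a move, are expressed by finitely many subwords of `x`.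

It remains to define the words all of whose gaps (the factors following the separators) belong to a
finite antichain `F`, by a `Σ₂` formula with three variables
(`SubwordLogic.Sigma2Def.mem_separatedWords`). The contents of a single gap are tested with probes
`sⁱ u sʲ`: if `x` has exactly `i + j` separators, such a probe is a subword of `x` only if its
separators are matched with all separators of `x`, so that `u` is a subword of the gap number `i`.
Since a finitely generated downward closed set of words is defined by finitely many obstructions,
one can say with probes that all gaps of `x` are subwords of words in `F`
(`SubwordLogic.mem_separatedWords_downClosure_iff`). To exclude proper subwords of words in `F`, let
`k` be a further letter, `W` a word that contains all words in `F`, and `w` a word with as many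
separators as `x` all of whose gaps contain `k W k`; this is again said with probes. If a gap of `x`
were a proper subword of a word in `F`, enclosing it by two letters `k` would give a word between
`x` and `w` in which two letters `k` enclose only a proper subword of a word in `F`. If all gaps of
`x` are in `F` and `w = s k W k ⋯ s k W k`, no such word exists, because `F` is an antichain
(`SubwordLogic.not_enclosed_of_forall_mem`, `SubwordLogic.forall_mem_of_not_enclosed`).

The resulting sentences depend on `m` only through the constants for the `m` and `m + 1` occurrences
of `load`. Hence their codes are computable from `m`, and a decision procedure for the truth problem
would decide the halting problem.
-/

/-! ### A Turing machine with undecidable halting on tally inputs -/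

open Turing in
/-- In little-endian binary notation without leading zeros, `2 ^ m - 1` consists of `m` ones. -/
theorem Turing.PartrecToTM2.trNat_two_pow_sub_one (m : ℕ) :
    PartrecToTM2.trNat (2 ^ m - 1) = List.replicate m PartrecToTM2.Γ'.bit1 := by
  induction m with
  | zero => simp
  | succ m ih =>
    have h : 2 ^ (m + 1) - 1 = 2 * (2 ^ m - 1) + 1 := by
      have := Nat.one_le_two_pow (n := m); rw [pow_succ]; omega
    have key : ∀ n : ℕ, PartrecToTM2.trNat (2 * n + 1)
        = PartrecToTM2.Γ'.bit1 :: PartrecToTM2.trNat n := by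
      intro n
      have : ((2 * n + 1 : ℕ) : Num) = Num.bit1 (n : Num) := by
        rw [← Num.of_to_nat (Num.bit1 (n : Num)), Num.cast_bit1]; simp [two_mul]
      rw [PartrecToTM2.trNat, this, PartrecToTM2.trNat]
      cases (n : Num) <;> rfl
    rw [h, key, ih, List.replicate_succ]

/-- The exponent `m` can be computed from the number `2 ^ m - 1`. -/
theorem Nat.exists_primrec_two_pow_sub_one_leftInverse :
    ∃ g : ℕ → ℕ, Primrec g ∧ ∀ m, g (2 ^ m - 1) = m := by
  refine ⟨fun n => Nat.findGreatest (fun m => 2 ^ m - 1 ≤ n) n, ?_, fun m => ?_⟩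
  · have hmul : Primrec₂ fun _ k : ℕ => k * 2 :=
      _root_.Primrec.nat_mul.comp _root_.Primrec.snd (_root_.Primrec.const 2)
    have hpow : Primrec fun m : ℕ => 2 ^ m := by
      refine (_root_.Primrec.nat_rec₁ 1 (f := fun _ k => k * 2) hmul).of_eq
        fun m => ?_
      induction m with
      | zero => rfl
      | succ m ih => rw [pow_succ, ← ih]
    refine Primrec.nat_findGreatest _root_.Primrec.id ?_
    exact Primrec.nat_le.comp (Primrec.nat_sub.comp (hpow.comp _root_.Primrec.snd) (_root_.Primrec.const 1))
      _root_.Primrec.fst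
  · have hm : m ≤ 2 ^ m - 1 := by have := Nat.lt_two_pow_self (n := m); omega
    rw [Nat.findGreatest_eq_iff]
    refine ⟨hm, fun _ => le_rfl, fun k hk _ => ?_⟩
    have : 2 ^ m < 2 ^ k := Nat.pow_lt_pow_right (by norm_num) hk
    have := Nat.one_le_two_pow (n := m)
    omega

open Turing in
/-- A fixed Turing machine with finitely many letters and states whose halting problem is
undecidable already for the inputs `a b ⋯ b`. It is obtained from a universal partial recursive
function, which is made to read `m` off the argument `2 ^ m - 1`: the binary notation of this
argument, which the compiled machine finds on its tape, consists of equal digits. -/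
theorem Turing.TM0.exists_not_computablePred_halts :
    ∃ (Γ Λ : Type) (_ : Inhabited Γ) (_ : Finite Γ) (_ : Inhabited Λ) (M : TM0.Machine Γ Λ)
      (S : Set Λ) (a b : Γ), S.Finite ∧ TM0.Supports M S ∧
      ¬ ComputablePred fun m : ℕ => (TM0.eval M (a :: List.replicate m b)).Dom := by
  classical
  obtain ⟨g, hg, hgm⟩ := Nat.exists_primrec_two_pow_sub_one_leftInverse
  -- The partial function that maps `2 ^ m - 1` to the value at `0` of the `m`-th program.
  let f : ℕ →. ℕ := fun n => Nat.Partrec.Code.eval (Denumerable.ofNat Nat.Partrec.Code (g n)) 0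
  have hf : Partrec f := Nat.Partrec.Code.eval_part.comp
    ((Computable.ofNat Nat.Partrec.Code).comp hg.to_comp) (Computable.const 0)
  obtain ⟨c, hc⟩ := ToPartrec.Code.exists_code (n := 1) (f := fun v => f v.head)
    (Nat.Partrec'.part_iff₁.2 hf)
  let iΛ : Inhabited PartrecToTM2.Λ' :=
    ⟨PartrecToTM2.trNormal c PartrecToTM2.Cont'.halt⟩
  let M₁ := TM2to1.tr PartrecToTM2.tr
  have hS₁ := TM2to1.tr_supports PartrecToTM2.tr (PartrecToTM2.tr_supports c .halt)
  let β : PartrecToTM2.Γ' → TM2to1.Γ' PartrecToTM2.K' (fun _ => PartrecToTM2.Γ') := fun d =>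
    (false, Function.update (fun _ => none) PartrecToTM2.K'.main (some d))
  let b := β PartrecToTM2.Γ'.bit1
  let a : TM2to1.Γ' PartrecToTM2.K' (fun _ => PartrecToTM2.Γ') :=
    (true, Function.update (fun _ => none) PartrecToTM2.K'.main (some PartrecToTM2.Γ'.cons))
  refine ⟨TM2to1.Γ' PartrecToTM2.K' (fun _ => PartrecToTM2.Γ'), TM1to0.Λ' M₁, inferInstance,
    ?_, inferInstance, TM1to0.tr M₁, _, a, b, Finset.finite_toSet _,
    TM1to0.tr_supports M₁ hS₁, fun hcomp => ?_⟩
  · have : Finite PartrecToTM2.K' := Finite.of_surjective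
      (fun i : Fin 4 => ([.main, .rev, .aux, .stack] : List PartrecToTM2.K').get i)
      (by rintro (_ | _ | _ | _) <;> [exact ⟨0, rfl⟩; exact ⟨1, rfl⟩; exact ⟨2, rfl⟩; exact ⟨3, rfl⟩])
    unfold TM2to1.Γ'
    infer_instance
  · have key : ∀ m : ℕ, (TM0.eval (TM1to0.tr M₁) (a :: List.replicate m b)).Dom ↔
        (Nat.Partrec.Code.eval (Denumerable.ofNat Nat.Partrec.Code m) 0).Dom := by
      intro m
      have hin : a :: List.replicate m b =
          TM2to1.trInit PartrecToTM2.K'.main (PartrecToTM2.trList [2 ^ m - 1]) := by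
        simp only [TM2to1.trInit, Turing.PartrecToTM2.trNat_two_pow_sub_one, a, b, β,
          PartrecToTM2.trList, List.reverse_append, List.reverse_cons, List.reverse_nil,
          List.nil_append, List.reverse_replicate, List.singleton_append]
        exact congrArg _ (List.map_replicate (f := β)).symm
      rw [hin, TM1to0.tr_eval]
      refine (TM2to1.tr_eval_dom PartrecToTM2.tr PartrecToTM2.K'.main _).trans ?_
      have hinit : (TM2.init PartrecToTM2.K'.main (PartrecToTM2.trList [2 ^ m - 1])) =
          PartrecToTM2.init c [2 ^ m - 1] := by
        unfold TM2.init PartrecToTM2.init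
        congr 1
        funext k
        cases k <;> simp [PartrecToTM2.K'.elim, Function.update]
      have hev := hc (List.Vector.cons (2 ^ m - 1) List.Vector.nil)
      have : (TM2.eval PartrecToTM2.tr PartrecToTM2.K'.main
          (PartrecToTM2.trList [2 ^ m - 1])).Dom ↔ (f (2 ^ m - 1)).Dom := by
        unfold TM2.eval
        rw [hinit, PartrecToTM2.tr_eval]
        change (c.eval [2 ^ m - 1]).Dom ↔ _
        have h1 : (List.Vector.cons (2 ^ m - 1) List.Vector.nil).1 = [2 ^ m - 1] := rfl
        rw [h1] at hev
        rw [hev]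
        rfl
      rw [this]
      simp [f, hgm]
    have h2 : ComputablePred fun m : ℕ =>
        (Nat.Partrec.Code.eval (Denumerable.ofNat Nat.Partrec.Code m) 0).Dom :=
      hcomp.of_eq key
    apply ComputablePred.halting_problem 0
    obtain ⟨_, h3⟩ := h2
    refine ⟨inferInstance, (h3.comp (Computable.encode (α := Nat.Partrec.Code))).of_eq fun c => ?_⟩
    simp

/-! ### Simulation of Turing machines by string rewriting -/

/-- One step of the semi-Thue (string rewriting) system with rules `P`: a factor `l` of the word
is replaced by `r`, for a rule `(l, r)`. -/
def SemiThueStep {σ : Type} (P : Set (List σ × List σ)) (u v : List σ) : Prop :=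
  ∃ l r, (l, r) ∈ P ∧ ∃ α β, u = α ++ l ++ β ∧ v = α ++ r ++ β

namespace TMRewriting

open Turing Relation

/-- The symbols of the rewriting system of a Turing machine with states `Q` and letters `Γ`:
two end markers, the states, the tape letters, and a symbol announcing that the machine
has halted. -/
inductive TapeSym (Q Γ : Type) : Type where
  | left
  | right
  | state (q : Q)
  | tape (a : Γ)
  | halted

instance {Q Γ : Type} [Finite Q] [Finite Γ] : Finite (TapeSym Q Γ) := by
  refine Finite.of_injective (β := Option (Option (Option (Q ⊕ Γ))))
    (fun | .left => none | .right => some none | .halted => some (some none)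
         | .state q => some (some (some (.inl q))) | .tape a => some (some (some (.inr a)))) ?_
  intro x y h
  cases x <;> cases y <;> simp_all

variable {Γ Λ : Type} [Inhabited Γ] [Inhabited Λ]

open TapeSym in
/-- The rewriting rules of a Turing machine.  A state symbol stands to the left of the scanned
letter; blanks may be inserted at the ends, and the symbol `halted`, which replaces the state when
the machine stops, erases the tape. -/
inductive Rule (M : TM0.Machine Γ Λ) (S : Set Λ) : List (TapeSym S Γ) → List (TapeSym S Γ) → Prop
  | write (q q' : S) (a b : Γ) (h : M q a = some (q'.1, .write b)) :
      Rule M S [state q, tape a] [state q', tape b]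
  | moveRight (q q' : S) (a : Γ) (h : M q a = some (q'.1, .move .right)) :
      Rule M S [state q, tape a] [tape a, state q']
  | moveLeft (q q' : S) (a c : Γ) (h : M q a = some (q'.1, .move .left)) :
      Rule M S [tape c, state q, tape a] [state q', tape c, tape a]
  | padRight (q : S) : Rule M S [state q, right] [state q, tape default, right]
  | padLeft (q : S) : Rule M S [left, state q] [left, tape default, state q]
  | halt (q : S) (a : Γ) (h : M q a = none) : Rule M S [state q, tape a] [halted]
  | eraseRight (a : Γ) : Rule M S [halted, tape a] [halted]
  | eraseLeft (a : Γ) : Rule M S [tape a, halted] [halted]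

variable (M : TM0.Machine Γ Λ) (S : Set Λ)

/-- The set of rewriting rules of a Turing machine. -/
def rules : Set (List (TapeSym S Γ) × List (TapeSym S Γ)) := {p | Rule M S p.1 p.2}

theorem finite_rules [Finite S] [Finite Γ] : (rules M S).Finite := by
  have h : {l : List (TapeSym S Γ) | l.length ≤ 3}.Finite := List.finite_length_le _ 3
  refine (h.prod h).subset ?_
  rintro ⟨l, r⟩ hlr
  change Rule M S l r at hlr
  constructor <;> cases hlr <;> simp

open TapeSym in
/-- The word `w` represents the configuration `c`; the representation is not unique, since any
number of blanks may be written at the ends. -/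
def Encodes (c : TM0.Cfg Γ Λ) (w : List (TapeSym S Γ)) : Prop :=
  ∃ (L R : List Γ) (q : S), w = left :: (L.reverse.map tape ++ state q :: (R.map tape ++ [right])) ∧
    c = ⟨q, Tape.mk' (ListBlank.mk L) (ListBlank.mk R)⟩

variable {M S}

theorem step_of_rule {l r : List (TapeSym S Γ)} (h : Rule M S l r) (α β : List (TapeSym S Γ)) :
    SemiThueStep (rules M S) (α ++ l ++ β) (α ++ r ++ β) :=
  ⟨l, r, h, α, β, rfl, rfl⟩

theorem mk_nil_eq : (ListBlank.mk ([] : List Γ)) = ListBlank.mk [default] :=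
  Quotient.sound' (Or.inl ⟨1, rfl⟩)

open TapeSym in
/-- By inserting blanks one can achieve that the state symbol has a tape letter on either side. -/
theorem Encodes.exists_pad {c : TM0.Cfg Γ Λ} {w : List (TapeSym S Γ)} (h : Encodes S c w) :
    ∃ (x a : Γ) (L R : List Γ) (q : S), ReflTransGen (SemiThueStep (rules M S)) w
      (left :: (L.reverse.map tape ++ tape x :: state q :: tape a :: (R.map tape ++ [right]))) ∧
      c = ⟨q, Tape.mk' (ListBlank.mk (x :: L)) (ListBlank.mk (a :: R))⟩ := by
  obtain ⟨L, R, q, rfl, rfl⟩ := h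
  have hR : ∃ a R', ReflTransGen (SemiThueStep (rules M S))
      (left :: (L.reverse.map tape ++ state q :: (R.map tape ++ [right])))
      (left :: (L.reverse.map tape ++ state q :: tape a :: (R'.map tape ++ [right]))) ∧
      ListBlank.mk R = ListBlank.mk (a :: R') := by
    cases R with
    | cons a R => exact ⟨a, R, .refl, rfl⟩
    | nil =>
      refine ⟨default, [], .single ?_, mk_nil_eq⟩
      simpa using step_of_rule (Rule.padRight (M := M) q) (left :: L.reverse.map tape) []
  obtain ⟨a, R', hR₁, hR₂⟩ := hR
  rw [hR₂]
  cases L with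
  | cons x L => exact ⟨x, a, L, R', q, by simpa using hR₁, rfl⟩
  | nil =>
    refine ⟨default, a, [], R', q, hR₁.tail ?_, by rw [mk_nil_eq]⟩
    simpa using step_of_rule (Rule.padLeft (M := M) q) [] (tape a :: (R'.map tape ++ [right]))

theorem mk'_head_eq (L R : List Γ) (a : Γ) :
    (Tape.mk' (ListBlank.mk L) (ListBlank.mk (a :: R))).1 = a := rfl

theorem Encodes.exists_of_step (hS : TM0.Supports M S) {c c' : TM0.Cfg Γ Λ} {w : List (TapeSym S Γ)}
    (h : Encodes S c w) (hc : c' ∈ TM0.step M c) :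
    ∃ w', Encodes S c' w' ∧ ReflTransGen (SemiThueStep (rules M S)) w w' := by
  obtain ⟨x, a, L, R, q, hw, rfl⟩ := h.exists_pad (M := M)
  obtain ⟨⟨q', s⟩, hM, rfl⟩ := Option.map_eq_some_iff.1 hc
  rw [mk'_head_eq] at hM
  have hq' : q' ∈ S := hS.2 hM q.2
  rcases s with (_ | _) | b
  · refine ⟨_, ⟨L, x :: a :: R, ⟨q', hq'⟩, rfl, ?_⟩, hw.tail ?_⟩
    · simp [Tape.move_left_mk', ← ListBlank.cons_mk]
    · simpa using step_of_rule (Rule.moveLeft q ⟨q', hq'⟩ a x hM)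
        (TapeSym.left :: L.reverse.map TapeSym.tape)
        (R.map TapeSym.tape ++ [TapeSym.right])
  · refine ⟨_, ⟨a :: x :: L, R, ⟨q', hq'⟩, rfl, ?_⟩, hw.tail ?_⟩
    · simp [Tape.move_right_mk', ← ListBlank.cons_mk]
    · simpa using
      step_of_rule (Rule.moveRight q ⟨q', hq'⟩ a hM)
        (TapeSym.left :: (x :: L).reverse.map TapeSym.tape) (R.map TapeSym.tape ++ [TapeSym.right])
  · refine ⟨_, ⟨x :: L, b :: R, ⟨q', hq'⟩, rfl, ?_⟩, hw.tail ?_⟩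
    · simp only [← ListBlank.cons_mk, Tape.write_mk', ListBlank.tail_cons]
    · simpa using
      step_of_rule (Rule.write q ⟨q', hq'⟩ a b hM)
        (TapeSym.left :: (x :: L).reverse.map TapeSym.tape) (R.map TapeSym.tape ++ [TapeSym.right])

open TapeSym in
theorem erase_tape (L R : List Γ) : ReflTransGen (SemiThueStep (rules M S))
    (left :: (L.reverse.map tape ++ halted :: (R.map tape ++ [right]))) [left, halted, right] := by
  induction R with
  | cons a R ih =>
    refine ReflTransGen.head ?_ ih
    simpa using step_of_rule (Rule.eraseRight (M := M) (S := S) a) (left :: L.reverse.map tape)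
      (R.map tape ++ [right])
  | nil =>
    induction L with
    | nil => exact .refl
    | cons x L ih =>
      refine ReflTransGen.head ?_ ih
      simpa using step_of_rule (Rule.eraseLeft (M := M) (S := S) x) (left :: L.reverse.map tape)
        [right]

theorem Encodes.reaches_halted {c : TM0.Cfg Γ Λ} {w : List (TapeSym S Γ)}
    (h : Encodes S c w) (hc : TM0.step M c = none) :
    ReflTransGen (SemiThueStep (rules M S)) w [.left, .halted, .right] := by
  obtain ⟨x, a, L, R, q, hw, rfl⟩ := h.exists_pad (M := M)
  have hM : M q a = none := Option.map_eq_none_iff.1 hc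
  refine (hw.tail ?_).trans (erase_tape (x :: L) R)
  simpa using
      step_of_rule (Rule.halt q a hM)
    (TapeSym.left :: (x :: L).reverse.map TapeSym.tape) (R.map TapeSym.tape ++ [TapeSym.right])

/-- A word that represents a configuration contains a single state symbol, so that every rule that
applies to it either inserts a blank or simulates the step of the machine. -/
theorem Encodes.of_semiThueStep {c : TM0.Cfg Γ Λ} {u v : List (TapeSym S Γ)}
    (h : Encodes S c u) (huv : SemiThueStep (rules M S) u v) :
    TM0.step M c = none ∨ Encodes S c v ∨ ∃ c' ∈ TM0.step M c, Encodes S c' v := by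
  obtain ⟨L, R, q, rfl, rfl⟩ := h
  obtain ⟨l, r, hlr, α, β, hu, rfl⟩ := huv
  -- The state symbol in the rule is the only one in the word.
  have hst : ∀ (p : S) (α β : List (TapeSym S Γ)),
      TapeSym.left :: (L.reverse.map TapeSym.tape ++
        TapeSym.state q :: (R.map TapeSym.tape ++ [TapeSym.right])) = α ++ TapeSym.state p :: β →
      TapeSym.left :: L.reverse.map TapeSym.tape = α ∧ q = p ∧
        R.map TapeSym.tape ++ [TapeSym.right] = β := by
    intro p α β h
    rw [← List.cons_append, List.append_cons_inj_of_notMem (by simp) (by simp)] at h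
    simpa using h
  have htape : ∀ (a : Γ) (β : List (TapeSym S Γ)),
      R.map TapeSym.tape ++ [TapeSym.right] = TapeSym.tape a :: β →
      ∃ R', R = a :: R' ∧ β = R'.map TapeSym.tape ++ [TapeSym.right] := by
    intro a β h
    cases R with
    | nil => simp at h
    | cons b R => simp only [List.map_cons, List.cons_append, List.cons.injEq, TapeSym.tape.injEq] at h
                  exact ⟨R, by rw [h.1], h.2.symm⟩
  change Rule M S l r at hlr
  cases hlr with
  | write p p' a b hM =>
    obtain ⟨rfl, rfl, h⟩ := hst p α (TapeSym.tape a :: β) (by simpa using hu)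
    obtain ⟨R', rfl, rfl⟩ := htape _ _ h
    refine .inr (.inr ⟨_, Option.map_eq_some_iff.2 ⟨_, hM, rfl⟩, L, b :: R', p', by simp, ?_⟩)
    simp only [← ListBlank.cons_mk, Tape.write_mk', ListBlank.tail_cons]
  | moveRight p p' a hM =>
    obtain ⟨rfl, rfl, h⟩ := hst p α (TapeSym.tape a :: β) (by simpa using hu)
    obtain ⟨R', rfl, rfl⟩ := htape _ _ h
    refine .inr (.inr ⟨_, Option.map_eq_some_iff.2 ⟨_, hM, rfl⟩, a :: L, R', p', by simp, ?_⟩)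
    simp [Tape.move_right_mk', ← ListBlank.cons_mk]
  | moveLeft p p' a x hM =>
    obtain ⟨h', rfl, h⟩ := hst p (α ++ [TapeSym.tape x]) (TapeSym.tape a :: β) (by simpa using hu)
    obtain ⟨R', rfl, rfl⟩ := htape _ _ h
    cases L with
    | nil =>
      have := congrArg List.getLast? h'
      simp at this
    | cons y L =>
      simp only [List.reverse_cons, List.map_append, List.map_cons, List.map_nil,
        ← List.cons_append] at h'
      obtain ⟨rfl, h'⟩ := List.append_inj' h' rfl
      obtain rfl : y = x := by simpa using h'
      refine .inr (.inr ⟨_, Option.map_eq_some_iff.2 ⟨_, hM, rfl⟩, L, y :: a :: R', p', by simp, ?_⟩)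
      simp [Tape.move_left_mk', ← ListBlank.cons_mk]
  | padRight p =>
    obtain ⟨rfl, rfl, h⟩ := hst p α (TapeSym.right :: β) (by simpa using hu)
    cases R with
    | cons b R => simp at h
    | nil =>
      obtain rfl : β = [] := by simpa using h.symm
      exact .inr (.inl ⟨L, [default], q, by simp, by rw [mk_nil_eq]⟩)
  | padLeft p =>
    obtain ⟨h', rfl, rfl⟩ := hst p (α ++ [TapeSym.left]) β (by simpa using hu)
    rcases List.eq_nil_or_concat L.reverse with hL | ⟨L', x, hL⟩
    · rw [List.reverse_eq_nil_iff] at hL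
      subst hL
      obtain rfl : α = [] := by
        have := congrArg List.length h'
        simpa using this
      exact .inr (.inl ⟨[default], R, q, by simp, by rw [mk_nil_eq]⟩)
    · rw [hL, List.concat_eq_append, List.map_append, ← List.cons_append] at h'
      cases (List.append_inj' h' rfl).2
  | halt p a hM =>
    obtain ⟨rfl, rfl, h⟩ := hst p α (TapeSym.tape a :: β) (by simpa using hu)
    obtain ⟨R', rfl, rfl⟩ := htape _ _ h
    exact .inl (Option.map_eq_none_iff.2 hM)
  | eraseRight a =>
    have : TapeSym.halted ∈ α ++ [TapeSym.halted, TapeSym.tape a] ++ β := by simp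
    rw [← hu] at this
    simp at this
  | eraseLeft a =>
    have : TapeSym.halted ∈ α ++ [TapeSym.tape a, TapeSym.halted] ++ β := by simp
    rw [← hu] at this
    simp at this

/-- The machine halts iff the word of its initial configuration rewrites to the final word. -/
theorem eval_dom_iff (hS : TM0.Supports M S) (a : Γ) (l : List Γ) :
    (TM0.eval M (a :: l)).Dom ↔ ReflTransGen (SemiThueStep (rules M S))
      (.left :: .state ⟨default, hS.1⟩ :: .tape a :: (l.map .tape ++ [.right]))
      [.left, .halted, .right] := by
  have hinit : Encodes S (TM0.init (a :: l))
      (.left :: .state ⟨default, hS.1⟩ :: .tape a :: (l.map .tape ++ [.right])) :=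
    ⟨[], a :: l, ⟨default, hS.1⟩, by simp, rfl⟩
  have hdom : (TM0.eval M (a :: l)).Dom ↔
      ∃ c, StateTransition.Reaches (TM0.step M) (TM0.init (a :: l)) c ∧ TM0.step M c = none := by
    change (StateTransition.eval (TM0.step M) (TM0.init (a :: l))).Dom ↔ _
    rw [Part.dom_iff_mem]
    simp only [StateTransition.mem_eval]
  rw [hdom]
  constructor
  · rintro ⟨c, hc, hn⟩
    have : ∃ w, Encodes S c w ∧ ReflTransGen (SemiThueStep (rules M S))
        (.left :: .state ⟨default, hS.1⟩ :: .tape a :: (l.map .tape ++ [.right])) w := by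
      clear hn
      induction hc with
      | refl => exact ⟨_, hinit, .refl⟩
      | tail _ h ih =>
        obtain ⟨w, hw, hr⟩ := ih
        obtain ⟨w', hw', hr'⟩ := hw.exists_of_step hS h
        exact ⟨w', hw', hr.trans hr'⟩
    obtain ⟨w, hw, hr⟩ := this
    exact hr.trans (hw.reaches_halted hn)
  · intro h
    by_contra hno
    have key : ∀ w, ReflTransGen (SemiThueStep (rules M S))
        (.left :: .state ⟨default, hS.1⟩ :: .tape a :: (l.map .tape ++ [.right])) w →
        ∃ c, StateTransition.Reaches (TM0.step M) (TM0.init (a :: l)) c ∧ Encodes S c w := by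
      intro w hw
      induction hw with
      | refl => exact ⟨_, .refl, hinit⟩
      | tail _ h ih =>
        obtain ⟨c, hc, hw⟩ := ih
        rcases hw.of_semiThueStep h with hn | h | ⟨c', hc', h⟩
        · exact absurd ⟨c, hc, hn⟩ hno
        · exact ⟨c, hc, h⟩
        · exact ⟨c', hc.tail hc', h⟩
    obtain ⟨c, -, L, R, q, hw, -⟩ := key _ h
    have : TapeSym.state q ∈ ([.left, .halted, .right] : List (TapeSym S Γ)) := by
      rw [hw]; simp
    simp at this

end TMRewriting

/-! ### Transcripts of derivations -/

namespace SemiThueStep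

open Relation

variable {σ : Type} {P : Set (List σ × List σ)}

theorem append_left {u v : List σ} (x : List σ) (h : SemiThueStep P u v) :
    SemiThueStep P (x ++ u) (x ++ v) := by
  obtain ⟨l, r, hlr, α, β, rfl, rfl⟩ := h
  exact ⟨l, r, hlr, x ++ α, β, by simp, by simp⟩

theorem append_right {u v : List σ} (x : List σ) (h : SemiThueStep P u v) :
    SemiThueStep P (u ++ x) (v ++ x) := by
  obtain ⟨l, r, hlr, α, β, rfl, rfl⟩ := h
  exact ⟨l, r, hlr, α, β ++ x, by simp, by simp⟩

theorem reflTransGen_append {u v u' v' : List σ} (h : ReflTransGen (SemiThueStep P) u v)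
    (h' : ReflTransGen (SemiThueStep P) u' v') :
    ReflTransGen (SemiThueStep P) (u ++ u') (v ++ v') :=
  (h.lift (· ++ u') fun _ _ => append_right u').trans (h'.lift (v ++ ·) fun _ _ => append_left v)

end SemiThueStep

/-- The moves of which the transcript of a derivation in a semi-Thue system `P` over `σ` is made:
`start`, `load` and `go` write the first word of the derivation, `copy`, `rule` and `row` transform
each word into the next one, and `finish` consumes the last word. -/
inductive Move {σ : Type} (P : Set (List σ × List σ)) : Type where
  | start
  | load
  | go
  | copy (s : σ)
  | row
  | rule (p : P)
  | finish

namespace Move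

open Relation

variable {σ : Type} {P : Set (List σ × List σ)}

instance [Finite σ] [Finite P] : Finite (Move P) := by
  refine Finite.of_injective (β := Fin 5 ⊕ (σ ⊕ P))
    (fun | .start => .inl 0 | .load => .inl 1 | .go => .inl 2 | .row => .inl 3 | .finish => .inl 4
         | .copy s => .inr (.inl s) | .rule p => .inr (.inr p)) ?_
  intro x y h
  cases x <;> cases y <;> simp_all

/-- The word that a move consumes; `none` separates the words of the derivation. -/
def consumed (wf : List σ) : Move P → List (Option σ)
  | start | load | go => []
  | copy s => [some s]
  | row => [none]
  | rule p => p.1.1.map some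
  | finish => wf.map some ++ [none]

/-- The word that a move produces.  The first word of the derivation has the form `u b ⋯ b v`. -/
def produced (u : List σ) (b : σ) (v : List σ) : Move P → List (Option σ)
  | start => u.map some
  | load => [some b]
  | go => v.map some ++ [none]
  | copy s => [some s]
  | row => [none]
  | rule p => p.1.2.map some
  | finish => []

/-- The phase of a transcript to which a move belongs. -/
def phase : Move P → ℕ
  | start => 0
  | load => 1
  | go => 2
  | copy _ | row | rule _ => 3
  | finish => 4

/-- The move `a` may precede the move `b`, not necessarily immediately. -/
def Precedes (a b : Move P) : Prop :=
  a.phase < b.phase ∨ a.phase = b.phase ∧ (a.phase = 1 ∨ a.phase = 3)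

variable {wf u v : List σ} {b : σ}

/-- Between two row separators, a transcript consumes a word and produces a word derivable
from it. -/
theorem exists_derivation_of_phase_eq_three {ms : List (Move P)}
    (h : ∀ m ∈ ms, m.phase = 3 ∧ m ≠ row) :
    ∃ y z : List σ, ms.flatMap (consumed wf) = y.map some ∧
      ms.flatMap (produced u b v) = z.map some ∧ ReflTransGen (SemiThueStep P) y z := by
  induction ms with
  | nil => exact ⟨[], [], rfl, rfl, .refl⟩
  | cons m ms ih =>
    obtain ⟨y, z, hy, hz, hyz⟩ := ih fun m hm => h m (List.mem_cons_of_mem _ hm)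
    obtain ⟨hm, hm'⟩ := h m List.mem_cons_self
    have : ∃ y z : List σ, consumed wf m = y.map some ∧ produced u b v m = z.map some ∧
        ReflTransGen (SemiThueStep P) y z := by
      cases m with
      | copy s => exact ⟨[s], [s], rfl, rfl, .refl⟩
      | rule p => exact ⟨_, _, rfl, rfl, .single ⟨p.1.1, p.1.2, p.2, [], [], by simp, by simp⟩⟩
      | row => exact absurd rfl hm'
      | _ => simp [phase] at hm
    obtain ⟨y', z', hy', hz', hyz'⟩ := this
    exact ⟨y' ++ y, z' ++ z, by simp [hy, hy'], by simp [hz, hz'],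
      SemiThueStep.reflTransGen_append hyz' hyz⟩

theorem eq_and_eq_of_map_some_append {c y : List σ} {X Y : List (Option σ)}
    (h : c.map some ++ none :: X = y.map some ++ none :: Y) : c = y ∧ X = Y := by
  induction c generalizing y with
  | nil => cases y <;> simp_all
  | cons s c ih =>
    cases y with
    | nil => simp at h
    | cons t y =>
      simp only [List.map_cons, List.cons_append, List.cons.injEq, Option.some.injEq] at h
      obtain ⟨rfl, rfl⟩ := ih h.2
      exact ⟨by rw [h.1], rfl⟩

/-- If the words produced, after a first word `c`, are the words consumed, before a last word `wf`,
then each word of the transcript is derivable from its predecessor, and so `wf` from `c`. -/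
theorem reflTransGen_of_flatMap_eq (ms : List (Move P)) (h : ∀ m ∈ ms, m.phase = 3) (c : List σ)
    (heq : c.map some ++ none :: ms.flatMap (produced u b v) =
      ms.flatMap (consumed wf) ++ (wf.map some ++ [none])) :
    ReflTransGen (SemiThueStep P) c wf := by
  classical
  induction hn : ms.length using Nat.strong_induction_on generalizing ms c with
  | _ n ih =>
    by_cases hr : (row : Move P) ∈ ms
    · obtain ⟨ms₁, ms₂, rfl, hr₁⟩ := List.eq_append_cons_of_mem hr
      obtain ⟨y, z, hy, hz, hyz⟩ := exists_derivation_of_phase_eq_three (wf := wf) (u := u) (v := v)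
        (b := b) (ms := ms₁) fun m hm => ⟨h m (by simp [hm]), fun e => hr₁ (e ▸ hm)⟩
      simp only [List.flatMap_append, List.flatMap_cons, hy, hz, consumed, produced,
        List.cons_append, List.nil_append, List.append_assoc] at heq
      obtain ⟨rfl, heq'⟩ := eq_and_eq_of_map_some_append heq
      exact hyz.trans (ih ms₂.length (by simp [← hn]; omega) ms₂ (fun m hm => h m (by simp [hm]))
        z heq' rfl)
    · obtain ⟨y, z, hy, hz, hyz⟩ := exists_derivation_of_phase_eq_three (wf := wf) (u := u) (v := v)
        (b := b) (ms := ms) fun m hm => ⟨h m hm, fun e => hr (e ▸ hm)⟩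
      rw [hy, hz, ← List.append_assoc, ← List.map_append] at heq
      obtain ⟨rfl, hz⟩ := eq_and_eq_of_map_some_append heq
      obtain rfl : z = [] := by simpa using hz
      simpa using SemiThueStep.reflTransGen_append hyz (.refl : ReflTransGen _ wf wf)

theorem flatMap_produced_copy (w : List σ) :
    (w.map (copy (P := P))).flatMap (produced u b v) = w.map some := by
  induction w with
  | nil => rfl
  | cons s w ih => simp [produced, ih]

theorem flatMap_consumed_copy (w : List σ) :
    (w.map (copy (P := P))).flatMap (consumed wf) = w.map some := by
  induction w with
  | nil => rfl
  | cons s w ih => simp [consumed, ih]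

/-- A derivation is written down one step per row: the letters around the replaced factor are copied. -/
theorem exists_transcript_of_reflTransGen {c : List σ}
    (h : ReflTransGen (SemiThueStep P) c wf) :
    ∃ ms : List (Move P), (∀ m ∈ ms, m.phase = 3) ∧
      c.map some ++ none :: ms.flatMap (produced u b v) =
        ms.flatMap (consumed wf) ++ (wf.map some ++ [none]) := by
  induction h using ReflTransGen.head_induction_on with
  | refl => exact ⟨[], by simp, by simp⟩
  | head hstep _ ih =>
    obtain ⟨ms, hms, heq⟩ := ih
    obtain ⟨l, r, hlr, α, β, rfl, rfl⟩ := hstep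
    refine ⟨α.map copy ++ rule ⟨(l, r), hlr⟩ :: (β.map copy ++ row :: ms), ?_, ?_⟩
    · intro m hm
      simp only [List.mem_append, List.mem_map, List.mem_cons] at hm
      rcases hm with ⟨s, -, rfl⟩ | rfl | ⟨s, -, rfl⟩ | rfl | hm
      · rfl
      · rfl
      · rfl
      · rfl
      · exact hms m hm
    · simp only [List.flatMap_append, List.flatMap_cons, flatMap_produced_copy,
        flatMap_consumed_copy, consumed, produced, List.map_append, List.append_assoc,
        List.cons_append, List.nil_append] at heq ⊢
      rw [heq]

/-- The order conditions force the three initial phases of a transcript. -/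
theorem exists_eq_of_pairwise {ms : List (Move P)} (h : ms.Pairwise Precedes)
    (hstart : start ∈ ms) (hgo : go ∈ ms) (hfinish : finish ∈ ms) :
    ∃ (n : ℕ) (os : List (Move P)), (∀ m ∈ os, m.phase = 3) ∧
      ms = start :: (List.replicate n load ++ go :: (os ++ [finish])) := by
  obtain ⟨x, y, rfl⟩ := List.append_of_mem hgo
  rw [List.pairwise_append, List.pairwise_cons] at h
  obtain ⟨hx, ⟨hgy, hy⟩, hxy⟩ := h
  have hxgo : ∀ m ∈ x, m.phase < 2 := fun m hm => by
    have := hxy m hm go List.mem_cons_self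
    change m.phase < 2 ∨ m.phase = 2 ∧ (m.phase = 1 ∨ m.phase = 3) at this; omega
  have hgoy : ∀ m ∈ y, 2 < m.phase := fun m hm => by
    have := hgy m hm
    change 2 < m.phase ∨ 2 = m.phase ∧ (2 = 1 ∨ 2 = 3) at this; omega
  have hsx : start ∈ x := by
    rcases List.mem_append.1 hstart with h | h
    · exact h
    · rcases List.mem_cons.1 h with h | h
      · cases h
      · exact absurd (hgoy _ h) (by simp [phase])
  have hsy : finish ∈ y := by
    rcases List.mem_append.1 hfinish with h | h
    · exact absurd (hxgo _ h) (by simp [phase])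
    · rcases List.mem_cons.1 h with h | h
      · cases h
      · exact h
  obtain ⟨x₁, x₂, rfl⟩ := List.append_of_mem hsx
  obtain ⟨y₁, y₂, rfl⟩ := List.append_of_mem hsy
  rw [List.pairwise_append, List.pairwise_cons] at hx hy
  obtain rfl : x₁ = [] := by
    refine List.eq_nil_iff_forall_not_mem.2 fun m hm => ?_
    have := hx.2.2 m hm start List.mem_cons_self
    change m.phase < 0 ∨ m.phase = 0 ∧ (m.phase = 1 ∨ m.phase = 3) at this; omega
  obtain rfl : y₂ = [] := by
    refine List.eq_nil_iff_forall_not_mem.2 fun m hm => ?_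
    have := hy.2.1.1 m hm
    have h4 : m.phase ≤ 4 := by cases m <;> simp [phase]
    change 4 < m.phase ∨ 4 = m.phase ∧ (4 = 1 ∨ 4 = 3) at this; omega
  have hx₂ : ∀ m ∈ x₂, m = load := fun m hm => by
    have h1 := hx.2.1.1 m hm
    have h2 := hxgo m (by simp [hm])
    simp only [Precedes, phase] at h1
    cases m <;> simp [phase] at h1 h2 ⊢
  have hy₁ : ∀ m ∈ y₁, m.phase = 3 := fun m hm => by
    have h1 := hy.2.2 m hm finish List.mem_cons_self
    have h2 := hgoy m (by simp [hm])
    change m.phase < 4 ∨ m.phase = 4 ∧ (m.phase = 1 ∨ m.phase = 3) at h1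
    omega
  refine ⟨x₂.length, y₁, hy₁, ?_⟩
  rw [← List.eq_replicate_of_mem hx₂]
  simp

theorem replicate_load_sublist_iff {k n : ℕ} {os : List (Move P)} (hos : ∀ m ∈ os, m.phase = 3) :
    (List.replicate k load).Sublist (start :: (List.replicate n load ++ go :: (os ++ [finish]))) ↔
      k ≤ n := by
  classical
  rw [List.replicate_sublist_iff]
  have : os.count load = 0 := List.count_eq_zero.2 fun h => by simpa [phase] using hos _ h
  simp [this]

/-- Derivability in a semi-Thue system, expressed by a single equation between the concatenations
of the words produced and consumed along a sequence of moves. -/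
theorem exists_transcript_iff (n : ℕ) :
    (∃ ms : List (Move P), ms.Pairwise Precedes ∧ start ∈ ms ∧ go ∈ ms ∧ finish ∈ ms ∧
      (List.replicate n load).Sublist ms ∧ ¬ (List.replicate (n + 1) load).Sublist ms ∧
      ms.flatMap (produced u b v) = ms.flatMap (consumed wf)) ↔
    ReflTransGen (SemiThueStep P) (u ++ (List.replicate n b ++ v)) wf := by
  have hload : ∀ n : ℕ, (List.replicate n (load : Move P)).flatMap (produced u b v) =
      (List.replicate n b).map some := by
    intro n
    induction n with
    | zero => rfl
    | succ n ih => simpa [List.replicate_succ, produced] using ih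
  have hload' : ∀ n : ℕ, (List.replicate n (load : Move P)).flatMap (consumed wf) = [] := by
    intro n
    simp [consumed]
  constructor
  · rintro ⟨ms, h, h1, h2, h3, h4, h5, heq⟩
    obtain ⟨k, os, hos, rfl⟩ := exists_eq_of_pairwise h h1 h2 h3
    rw [replicate_load_sublist_iff hos] at h4 h5
    obtain rfl : k = n := by omega
    refine reflTransGen_of_flatMap_eq (u := u) (v := v) (b := b) os hos _ ?_
    simpa [hload, hload', consumed, produced] using heq
  · intro h
    obtain ⟨os, hos, heq⟩ := exists_transcript_of_reflTransGen (u := u) (v := v) (b := b) h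
    refine ⟨start :: (List.replicate n load ++ go :: (os ++ [finish])), ?_, by simp, by simp,
      by simp, (replicate_load_sublist_iff hos).2 le_rfl,
      fun h => absurd ((replicate_load_sublist_iff hos).1 h) (by omega), ?_⟩
    · have hos' : os.Pairwise Precedes := List.pairwise_of_forall_mem_list fun a ha b hb =>
        Or.inr ⟨by rw [hos a ha, hos b hb], Or.inr (hos a ha)⟩
      simp only [List.pairwise_cons, List.pairwise_append, List.mem_append, List.mem_cons,
        List.mem_replicate, List.pairwise_replicate]
      refine ⟨?_, .inr (.inr ⟨rfl, .inl rfl⟩), ⟨?_, hos', by simp, ?_⟩, ?_⟩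
      · rintro m (⟨-, rfl⟩ | rfl | h | rfl | h)
        · simp [Precedes, phase]
        · simp [Precedes, phase]
        · simp [Precedes, hos m h]; simp [phase]
        · simp [Precedes, phase]
        · simp at h
      · rintro m (h | rfl | h)
        · simp [Precedes, hos m h]; simp [phase]
        · simp [Precedes, phase]
        · simp at h
      · rintro m hm _ (rfl | h)
        · simp [Precedes, hos m hm]; simp [phase]
        · simp at h
      · rintro _ ⟨-, rfl⟩ m (rfl | h | rfl | h)
        · simp [Precedes, phase]
        · simp [Precedes, hos m h]; simp [phase]
        · simp [Precedes, phase]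
        · simp at h
    · simpa [hload, hload', consumed, produced] using heq

end Move

/-! ### Gaps and probes -/

namespace SubwordLogic

variable {A : Type}

section Gaps

variable [DecidableEq A] {s : A}

/-- An occurrence of a letter `s` that has at least as many occurrences of `s` on either side
as an occurrence of `s` in a superword has to be matched with the latter. -/
theorem sublist_of_append_cons_sublist {p q p' q' : List A}
    (h : (p ++ s :: q).Sublist (p' ++ s :: q')) (hp : p'.count s ≤ p.count s)
    (hq : q'.count s ≤ q.count s) : p.Sublist p' ∧ q.Sublist q' := by
  obtain ⟨l₁, l₂, he, h₁, h₂⟩ := List.sublist_append_iff.1 h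
  have c₁ := h₁.count_le s
  have c₂ := h₂.count_le s
  simp only [List.count_cons_self] at c₂
  rcases List.append_eq_append_iff.1 he with ⟨c, rfl, hc⟩ | ⟨c, rfl, rfl⟩
  · cases c with
    | nil =>
      obtain rfl : l₂ = s :: q := by simpa using hc.symm
      rw [List.append_nil] at h₁
      exact ⟨h₁, List.cons_sublist_cons.1 h₂⟩
    | cons d c =>
      rw [List.cons_append, List.cons.injEq] at hc
      obtain ⟨rfl, -⟩ := hc
      simp at c₁
      omega
  · cases c with
    | nil =>
      rw [List.append_nil]
      exact ⟨h₁, List.cons_sublist_cons.1 h₂⟩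
    | cons d c =>
      exfalso
      simp only [List.count_append, List.count_cons_self, List.count_cons] at c₁ c₂ hp
      by_cases hd : d = s
      · subst hd; simp at c₁ c₂ hp; omega
      · have h₃ := (List.Sublist.of_cons_of_ne hd h₂).count_le s
        simp [hd] at h₃
        omega

/-- The word `s g₁ s g₂ ⋯ s gₙ` with the gaps `g₁, …, gₙ`. -/
def separated (s : A) (gs : List (List A)) : List A := gs.flatMap (s :: ·)

omit [DecidableEq A] in
@[simp] theorem separated_nil : separated s [] = [] := rfl

omit [DecidableEq A] in
@[simp] theorem separated_cons (g : List A) (gs : List (List A)) :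
    separated s (g :: gs) = s :: (g ++ separated s gs) := rfl

omit [DecidableEq A] in
@[simp] theorem separated_append (gs hs : List (List A)) :
    separated s (gs ++ hs) = separated s gs ++ separated s hs := by
  simp [separated]

omit [DecidableEq A] in
theorem exists_eq_append_separated (s : A) (x : List A) :
    ∃ g₀ gs, s ∉ g₀ ∧ (∀ g ∈ gs, s ∉ g) ∧ x = g₀ ++ separated s gs := by
  classical
  induction x with
  | nil => exact ⟨[], [], by simp, by simp, rfl⟩
  | cons c x ih =>
    obtain ⟨g₀, gs, h₀, h, rfl⟩ := ih
    by_cases hc : c = s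
    · subst hc
      exact ⟨[], g₀ :: gs, by simp, by simpa using ⟨h₀, h⟩, rfl⟩
    · exact ⟨c :: g₀, gs, by simpa [h₀] using Ne.symm hc, h, rfl⟩

theorem count_separated {gs : List (List A)} (h : ∀ g ∈ gs, s ∉ g) :
    (separated s gs).count s = gs.length := by
  induction gs with
  | nil => rfl
  | cons g gs ih =>
    have hg : g.count s = 0 := List.count_eq_zero.2 (h g List.mem_cons_self)
    simp [hg, ih fun g hg => h g (List.mem_cons_of_mem _ hg)]

omit [DecidableEq A] in
theorem mem_separated {gs : List (List A)} {c : A} (hc : c ≠ s) :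
    c ∈ separated s gs ↔ ∃ g ∈ gs, c ∈ g := by
  simp [separated, hc]

omit [DecidableEq A] in
theorem separated_replicate_nil (n : ℕ) :
    separated s (List.replicate n []) = List.replicate n s := by
  induction n with
  | zero => rfl
  | succ n ih => simp [List.replicate_succ, ih]

omit [DecidableEq A] in
theorem separated_sublist_separated {gs hs : List (List A)}
    (h : List.Forall₂ List.Sublist gs hs) : (separated s gs).Sublist (separated s hs) := by
  induction h with
  | nil => exact List.Sublist.refl _
  | cons h _ ih => exact (h.append ih).cons_cons _

omit [DecidableEq A] in
theorem separated_sublist_separated_replicate {gs : List (List A)} {w : List A}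
    (h : ∀ g ∈ gs, g.Sublist w) :
    (separated s gs).Sublist (separated s (List.replicate gs.length w)) := by
  refine separated_sublist_separated ?_
  induction gs with
  | nil => exact .nil
  | cons g gs ih => exact .cons (h g List.mem_cons_self) (ih fun g hg => h g (List.mem_cons_of_mem _ hg))

omit [DecidableEq A] in
theorem separated_replicate_sublist_separated {gs : List (List A)} {w : List A}
    (h : ∀ g ∈ gs, w.Sublist g) :
    (separated s (List.replicate gs.length w)).Sublist (separated s gs) := by
  refine separated_sublist_separated ?_
  induction gs with
  | nil => exact .nil
  | cons g gs ih => exact .cons (h g List.mem_cons_self) (ih fun g hg => h g (List.mem_cons_of_mem _ hg))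

omit [DecidableEq A] in
theorem replicate_sublist_separated {gs : List (List A)} {n : ℕ} (h : n ≤ gs.length) :
    (List.replicate n s).Sublist (separated s gs) := by
  refine (List.replicate_sublist_replicate s |>.2 h).trans ?_
  rw [← separated_replicate_nil]
  exact separated_replicate_sublist_separated fun g _ => List.nil_sublist g

/-- Subwords with the maximal number of separators are embedded gap by gap. -/
theorem forall₂_sublist_of_separated_sublist {h₀ g₀ : List A} {hs gs : List (List A)}
    (hh : ∀ h ∈ hs, s ∉ h) (hg₀ : s ∉ g₀) (hg : ∀ g ∈ gs, s ∉ g) (hlen : gs.length = hs.length)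
    (hsub : (h₀ ++ separated s hs).Sublist (g₀ ++ separated s gs)) :
    h₀.Sublist g₀ ∧ List.Forall₂ List.Sublist hs gs := by
  induction hs generalizing h₀ g₀ gs with
  | nil =>
    obtain rfl : gs = [] := by simpa using hlen
    exact ⟨by simpa using hsub, .nil⟩
  | cons h hs ih =>
    cases gs with
    | nil => simp at hlen
    | cons g gs =>
      simp only [List.mem_cons, forall_eq_or_imp] at hh hg
      have hlen' : gs.length = hs.length := by simpa using hlen
      simp only [separated_cons] at hsub
      obtain ⟨h₁, h₂⟩ := sublist_of_append_cons_sublist hsub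
        (by rw [List.count_eq_zero.2 hg₀]; exact Nat.zero_le _)
        (by rw [List.count_append, List.count_append, count_separated hg.2, count_separated hh.2,
              List.count_eq_zero.2 hg.1]; omega)
      obtain ⟨h₃, h₄⟩ := ih hh.2 hg.1 hg.2 hlen' h₂
      exact ⟨h₁, .cons h₃ h₄⟩

omit [DecidableEq A] in
theorem exists_of_forall₂_of_mem {α β : Type} {R : α → β → Prop} {l : List α} {l' : List β}
    (h : List.Forall₂ R l l') {a : α} (ha : a ∈ l) : ∃ b ∈ l', R a b := by
  induction h with
  | nil => simp at ha
  | cons h _ ih =>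
    rcases List.mem_cons.1 ha with rfl | ha
    · exact ⟨_, List.mem_cons_self, h⟩
    · obtain ⟨b, hb, hr⟩ := ih ha
      exact ⟨b, List.mem_cons_of_mem _ hb, hr⟩

/-- The word `s ⋯ s u s ⋯ s`, which probes the contents of a single gap. -/
def probe (s : A) (i : ℕ) (u : List A) (j : ℕ) : List A :=
  List.replicate i s ++ (u ++ List.replicate j s)

/-- A word is a probe as soon as `s` does not separate two other letters. -/
theorem exists_eq_probe {z : List A}
    (h : ∀ a b, a ≠ s → b ≠ s → ¬ [a, s, b].Sublist z) :
    ∃ i u j, s ∉ u ∧ z = probe s i u j := by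
  induction z with
  | nil => exact ⟨0, [], 0, by simp, rfl⟩
  | cons c z ih =>
    obtain ⟨i, u, j, hu, rfl⟩ := ih fun a b ha hb hab => h a b ha hb (hab.cons _)
    by_cases hc : c = s
    · subst hc
      exact ⟨i + 1, u, j, hu, rfl⟩
    · cases u with
      | nil =>
        refine ⟨0, [c], i + j, by simpa using Ne.symm hc, ?_⟩
        simp [probe, List.replicate_append_replicate]
      | cons b u =>
        cases i with
        | zero => exact ⟨0, c :: b :: u, j, by simpa [Ne.symm hc] using hu, rfl⟩
        | succ i =>
          refine absurd ?_ (h c b hc (by rintro rfl; simp at hu))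
          refine List.Sublist.cons_cons c ?_
          simp only [probe, List.replicate_succ, List.cons_append]
          refine List.Sublist.cons_cons s ?_
          exact (List.Sublist.cons_cons b (List.nil_sublist _)).trans
            (List.sublist_append_right _ _)

omit [DecidableEq A] in
theorem sublist_of_sublist_replicate_append {a : A} {l y : List A} {i : ℕ} (ha : a ≠ s)
    (h : (a :: l).Sublist (List.replicate i s ++ y)) : (a :: l).Sublist y := by
  induction i with
  | zero => simpa using h
  | succ i ih => exact ih (List.Sublist.of_cons_of_ne ha h)

omit [DecidableEq A] in
theorem sublist_of_sublist_append_replicate {l y : List A} {j : ℕ} (hl : s ∉ l)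
    (h : l.Sublist (y ++ List.replicate j s)) : l.Sublist y := by
  obtain ⟨l₁, l₂, rfl, h₁, h₂⟩ := List.sublist_append_iff.1 h
  have : l₂ = [] := List.eq_nil_iff_forall_not_mem.2 fun a ha => hl (by
    obtain rfl := List.eq_of_mem_replicate (h₂.subset ha)
    simp [ha])
  subst this
  simpa using h₁

omit [DecidableEq A] in
theorem sublist_of_sublist_probe {l u : List A} {i j : ℕ} (hl : s ∉ l)
    (h : l.Sublist (probe s i u j)) : l.Sublist u := by
  cases l with
  | nil => exact List.nil_sublist _
  | cons a l =>
    have ha : a ≠ s := by rintro rfl; simp at hl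
    exact sublist_of_sublist_append_replicate hl (sublist_of_sublist_replicate_append ha h)

omit [DecidableEq A] in
theorem sublist_probe {l u : List A} {i j : ℕ} (h : l.Sublist u) : l.Sublist (probe s i u j) :=
  (h.trans (List.sublist_append_left _ _)).trans (List.sublist_append_right _ _)

omit [DecidableEq A] in
theorem not_sublist_probe {u : List A} (hu : s ∉ u) (i j : ℕ) (a b : A) (ha : a ≠ s) (hb : b ≠ s) :
    ¬ [a, s, b].Sublist (probe s i u j) := by
  intro h
  have h := sublist_of_sublist_replicate_append ha h
  obtain ⟨l₁, l₂, he, h₁, h₂⟩ := List.sublist_append_iff.1 h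
  have hb' : b ∉ l₂ := fun h => hb (List.eq_of_mem_replicate (h₂.subset h))
  have hs' : s ∉ l₁ := fun h => hu (h₁.subset h)
  rcases l₁ with _ | ⟨c, _ | ⟨d, l₁⟩⟩
  · exact hb' (by rw [← (by simpa using he : [a, s, b] = l₂)]; simp)
  · exact hb' (by rw [← (by simpa using he : a = c ∧ [s, b] = l₂).2]; simp)
  · simp_all

theorem count_probe {u : List A} (hu : s ∉ u) (i j : ℕ) : (probe s i u j).count s = i + j := by
  simp [probe, List.count_eq_zero.2 hu]

omit [DecidableEq A] in
theorem probe_succ_eq_separated (i j : ℕ) (u : List A) :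
    probe s (i + 1) u j = separated s (List.replicate i [] ++ u :: List.replicate j []) := by
  simp [probe, separated_replicate_nil, List.replicate_succ']

omit [DecidableEq A] in
/-- A probe whose content precedes all separators is recognized by a letter that does not
occur after a separator. -/
theorem exists_succ_of_forall_sublist_probe {u : List A} {i j : ℕ} (hu : s ∉ u) (hne : u ≠ [])
    (h : ∀ c, c ≠ s → [c].Sublist (probe s i u j) → [s, c].Sublist (probe s i u j)) :
    ∃ i', i = i' + 1 := by
  cases i with
  | succ i => exact ⟨i, rfl⟩
  | zero =>
    exfalso
    obtain ⟨c, u, rfl⟩ := List.exists_cons_of_ne_nil hne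
    have hc : c ≠ s := by rintro rfl; simp at hu
    have := h c hc (sublist_probe (by simp))
    simp only [probe, List.replicate_zero, List.nil_append] at this
    obtain ⟨l₁, l₂, he, h₁, h₂⟩ := List.sublist_append_iff.1 this
    rcases l₁ with _ | ⟨d, l₁⟩
    · obtain rfl : l₂ = [s, c] := by simpa using he.symm
      exact hc (List.eq_of_mem_replicate (h₂.subset (by simp)))
    · have hd : d = s := by simp at he; exact he.1.symm
      subst hd
      exact hu (h₁.subset List.mem_cons_self)

omit [DecidableEq A] in
theorem sublist_probe_succ_of_mem {u : List A} {i j : ℕ} {c : A} (hc : c ∈ u) :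
    [s, c].Sublist (probe s (i + 1) u j) := by
  simp only [probe, List.replicate_succ, List.cons_append]
  refine List.Sublist.cons_cons s ?_
  exact (List.singleton_sublist.2 (by simp [hc]))

end Gaps

/-- A downward closed set of words that is generated by a finite set is the set of words that
avoid finitely many subwords. -/
theorem exists_finite_obstructions [Finite A] {D : Set (List A)} (hD : D.Finite) :
    ∃ O : Set (List A), O.Finite ∧ ∀ t, (∃ d ∈ D, t.Sublist d) ↔ ∀ u ∈ O, ¬ u.Sublist t := by
  obtain ⟨N, hN⟩ : ∃ N, ∀ d ∈ D, d.length < N := by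
    obtain ⟨N, hN⟩ := (hD.image List.length).bddAbove
    exact ⟨N + 1, fun d hd => Nat.lt_succ_of_le (hN ⟨d, hd, rfl⟩)⟩
  refine ⟨{u | u.length ≤ N ∧ ∀ d ∈ D, ¬ u.Sublist d},
    (List.finite_length_le A N).subset fun u hu => hu.1, fun t => ⟨?_, fun h => ?_⟩⟩
  · rintro ⟨d, hd, htd⟩ u ⟨-, hu⟩ hut
    exact hu d hd (hut.trans htd)
  · by_contra! hno
    by_cases ht : t.length ≤ N
    · exact h t ⟨ht, hno⟩ (List.Sublist.refl t)
    · refine h (t.take N) ⟨by simp, fun d hd hs => ?_⟩ (List.take_sublist N t)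
      have := hs.length_le
      have := hN d hd
      rw [List.length_take] at *
      omega

end SubwordLogic

/-! ### Definability with three variables -/

namespace SubwordLogic

namespace Formula

variable {A : Type}

theorem isSigma_isPi_mono (φ : Formula A) :
    (∀ n m, n ≤ m → (φ.IsSigma n → φ.IsSigma m) ∧ (φ.IsPi n → φ.IsPi m)) ∧
    (∀ n m, n < m → (φ.IsSigma n → φ.IsPi m) ∧ (φ.IsPi n → φ.IsSigma m)) := by
  induction φ with
  | sub s t => simp [IsSigma, IsPi]
  | neg φ ih =>
    simp only [IsSigma, IsPi]
    exact ⟨fun n m h => (ih.1 n m h).symm, fun n m h => (ih.2 n m h).symm⟩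
  | and φ ψ ih₁ ih₂ =>
    simp only [IsSigma, IsPi]
    exact ⟨fun n m h => ⟨And.imp (ih₁.1 n m h).1 (ih₂.1 n m h).1,
      And.imp (ih₁.1 n m h).2 (ih₂.1 n m h).2⟩, fun n m h => ⟨And.imp (ih₁.2 n m h).1 (ih₂.2 n m h).1,
      And.imp (ih₁.2 n m h).2 (ih₂.2 n m h).2⟩⟩
  | ex x φ ih =>
    simp only [IsSigma, IsPi]
    refine ⟨fun n m h => ⟨And.imp (by omega) (ih.1 n m h).1,
      And.imp (by omega) (ih.1 _ _ (by omega)).1⟩, fun n m h => ⟨fun hn => ⟨by omega, ?_⟩,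
      fun hn => ⟨by omega, ?_⟩⟩⟩
    · exact (ih.1 _ _ (by omega)).1 hn.2
    · exact (ih.1 _ _ (by omega)).1 hn.2
  | all x φ ih =>
    simp only [IsSigma, IsPi]
    refine ⟨fun n m h => ⟨And.imp (by omega) (ih.1 _ _ (by omega)).2,
      And.imp (by omega) (ih.1 n m h).2⟩, fun n m h => ⟨fun hn => ⟨by omega, ?_⟩,
      fun hn => ⟨by omega, ?_⟩⟩⟩
    · exact (ih.1 _ _ (by omega)).2 hn.2
    · exact (ih.1 _ _ (by omega)).2 hn.2

end Formula

open Formula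

variable {A : Type}

/-- The property `P` of valuations is expressed by a formula of the class `C` that uses no other
variables than `0`, `1` and `2`. -/
def Definable (C : Formula A → Prop) (P : (ℕ → List A) → Prop) : Prop :=
  ∃ φ, C φ ∧ φ.vars ⊆ Finset.range 3 ∧ ∀ v, φ.Sat v ↔ P v

/-- Definability by a quantifier-free formula: these are the formulas on all levels. -/
abbrev QFDef (P : (ℕ → List A) → Prop) : Prop :=
  Definable (fun φ => ∀ n, φ.IsSigma n ∧ φ.IsPi n) P

/-- Definability by a `Π₁` formula with three variables. -/
abbrev Pi1Def (P : (ℕ → List A) → Prop) : Prop := Definable (fun φ => φ.IsPi 1) P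

/-- Definability by a `Σ₂` formula with three variables. -/
abbrev Sigma2Def (P : (ℕ → List A) → Prop) : Prop := Definable (fun φ => φ.IsSigma 2) P

variable {P Q : (ℕ → List A) → Prop}

theorem Definable.congr {C : Formula A → Prop} (h : Definable C P) (hPQ : ∀ v, Q v ↔ P v) :
    Definable C Q := by
  obtain ⟨φ, h₁, h₂, h₃⟩ := h
  exact ⟨φ, h₁, h₂, fun v => (h₃ v).trans (hPQ v).symm⟩

theorem QFDef.var_sublist_var {i j : ℕ} (hi : i < 3) (hj : j < 3) :
    QFDef (A := A) fun v => (v i).Sublist (v j) :=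
  ⟨.sub (.var i) (.var j), by simp [IsSigma, IsPi], by
    simp [vars, Term.vars, Finset.insert_subset_iff, hi, hj], fun v => Iff.rfl⟩

theorem QFDef.const_sublist_var (w : List A) {j : ℕ} (hj : j < 3) :
    QFDef fun v => w.Sublist (v j) :=
  ⟨.sub (.const w) (.var j), by simp [IsSigma, IsPi], by
    simp [vars, Term.vars, hj], fun v => Iff.rfl⟩

theorem QFDef.not (h : QFDef P) : QFDef fun v => ¬ P v := by
  obtain ⟨φ, h₁, h₂, h₃⟩ := h
  exact ⟨.neg φ, fun n => by simpa only [IsSigma, IsPi] using (h₁ n).symm, h₂,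
    fun v => not_congr (h₃ v)⟩

theorem QFDef.and (hP : QFDef P) (hQ : QFDef Q) : QFDef fun v => P v ∧ Q v := by
  obtain ⟨φ, h₁, h₂, h₃⟩ := hP
  obtain ⟨ψ, k₁, k₂, k₃⟩ := hQ
  exact ⟨.and φ ψ, fun n => by
    simpa only [IsSigma, IsPi] using ⟨⟨(h₁ n).1, (k₁ n).1⟩, ⟨(h₁ n).2, (k₁ n).2⟩⟩,
    Finset.union_subset h₂ k₂, fun v => and_congr (h₃ v) (k₃ v)⟩

theorem QFDef.imp (hP : QFDef P) (hQ : QFDef Q) : QFDef fun v => P v → Q v :=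
  (hP.and hQ.not).not.congr fun v => by tauto

theorem QFDef.or (hP : QFDef P) (hQ : QFDef Q) : QFDef fun v => P v ∨ Q v :=
  (hP.not.and hQ.not).not.congr fun v => by tauto

theorem QFDef.iff (hP : QFDef P) (hQ : QFDef Q) : QFDef fun v => P v ↔ Q v :=
  ((hP.imp hQ).and (hQ.imp hP)).congr fun v => by tauto

theorem QFDef.forall_mem {ι : Type} {s : Set ι} (hs : s.Finite) {P : ι → (ℕ → List A) → Prop}
    (h : ∀ i, QFDef (P i)) : QFDef fun v => ∀ i ∈ s, P i v := by
  induction s, hs using Set.Finite.induction_on with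
  | empty =>
    refine (QFDef.const_sublist_var ([] : List A) (j := 0) (by norm_num)).congr fun v => ?_
    simp
  | @insert a _ _ _ ih => exact ((h a).and ih).congr fun v => by simp

theorem QFDef.pi1 (h : QFDef P) : Pi1Def P := by
  obtain ⟨φ, h₁, h₂, h₃⟩ := h
  exact ⟨φ, (h₁ 1).2, h₂, h₃⟩

theorem Pi1Def.and (hP : Pi1Def P) (hQ : Pi1Def Q) : Pi1Def fun v => P v ∧ Q v := by
  obtain ⟨φ, h₁, h₂, h₃⟩ := hP
  obtain ⟨ψ, k₁, k₂, k₃⟩ := hQ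
  exact ⟨.and φ ψ, by simpa only [IsPi] using ⟨h₁, k₁⟩,
    Finset.union_subset h₂ k₂, fun v => and_congr (h₃ v) (k₃ v)⟩

theorem Pi1Def.all {i : ℕ} (hi : i < 3) (hP : Pi1Def P) :
    Pi1Def fun v => ∀ w, P (Function.update v i w) := by
  obtain ⟨φ, h₁, h₂, h₃⟩ := hP
  exact ⟨.all i φ, by simpa only [IsPi] using ⟨le_rfl, h₁⟩,
    Finset.insert_subset (by simpa using hi) h₂, fun v => forall_congr' fun w => h₃ _⟩

theorem Pi1Def.sigma2 (h : Pi1Def P) : Sigma2Def P := by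
  obtain ⟨φ, h₁, h₂, h₃⟩ := h
  exact ⟨φ, ((isSigma_isPi_mono φ).2 1 2 (by norm_num)).2 h₁, h₂, h₃⟩

theorem Sigma2Def.and (hP : Sigma2Def P) (hQ : Sigma2Def Q) : Sigma2Def fun v => P v ∧ Q v := by
  obtain ⟨φ, h₁, h₂, h₃⟩ := hP
  obtain ⟨ψ, k₁, k₂, k₃⟩ := hQ
  exact ⟨.and φ ψ, by simpa only [IsSigma] using ⟨h₁, k₁⟩,
    Finset.union_subset h₂ k₂, fun v => and_congr (h₃ v) (k₃ v)⟩

theorem Sigma2Def.ex {i : ℕ} (hi : i < 3) (hP : Sigma2Def P) :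
    Sigma2Def fun v => ∃ w, P (Function.update v i w) := by
  obtain ⟨φ, h₁, h₂, h₃⟩ := hP
  exact ⟨.ex i φ, by simpa only [IsSigma] using ⟨one_le_two, h₁⟩,
    Finset.insert_subset (by simpa using hi) h₂, fun v => exists_congr fun w => h₃ _⟩

/-! ### Definability of gap languages -/

section GapLanguages

/-- The words in `s*`, in the form in which the logic expresses it. -/
def IsUnary (s : A) (z : List A) : Prop := ∀ c, c ≠ s → ¬ [c].Sublist z

theorem isUnary_iff {s : A} {z : List A} : IsUnary s z ↔ ∃ n, z = List.replicate n s := by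
  constructor
  · intro h
    refine ⟨z.length, List.eq_replicate_iff.2 ⟨rfl, fun c hc => ?_⟩⟩
    by_contra hne
    exact h c hne (List.singleton_sublist.2 hc)
  · rintro ⟨n, rfl⟩ c hc h
    exact hc (List.eq_of_mem_replicate (List.singleton_sublist.1 h))

/-- The words in which `s` does not separate two other letters; by `exists_eq_probe`, these are the
probes, in the form in which the logic expresses them. -/
def IsProbe (s : A) (z : List A) : Prop := ∀ a b, a ≠ s → b ≠ s → ¬ [a, s, b].Sublist z

/-- Every letter of `z` other than `s` occurs to the right of an `s`. -/
def StartsWith (s : A) (z : List A) : Prop := ∀ c, c ≠ s → [c].Sublist z → [s, c].Sublist z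

theorem QFDef.isUnary [Finite A] (s : A) {i : ℕ} (hi : i < 3) : QFDef fun v => IsUnary s (v i) :=
  (QFDef.forall_mem (s := {c | c ≠ s}) (Set.toFinite _)
    fun c => (QFDef.const_sublist_var [c] hi).not)

theorem QFDef.isProbe [Finite A] (s : A) {i : ℕ} (hi : i < 3) : QFDef fun v => IsProbe s (v i) :=
  (QFDef.forall_mem (s := {p : A × A | p.1 ≠ s ∧ p.2 ≠ s}) (Set.toFinite _)
    fun p => (QFDef.const_sublist_var [p.1, s, p.2] hi).not).congr fun v => by
      simp [IsProbe]

theorem QFDef.startsWith [Finite A] (s : A) {i : ℕ} (hi : i < 3) :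
    QFDef fun v => StartsWith s (v i) :=
  (QFDef.forall_mem (s := {c | c ≠ s}) (Set.toFinite _)
    fun c => (QFDef.const_sublist_var [c] hi).imp (QFDef.const_sublist_var [s, c] hi))

theorem QFDef.avoids {O : Set (List A)} (hO : O.Finite) (f : List A → List A) {i : ℕ} (hi : i < 3) :
    QFDef fun v => ∀ u ∈ O, ¬ (f u).Sublist (v i) :=
  QFDef.forall_mem hO fun u => (QFDef.const_sublist_var (f u) hi).not

/-- Finitely many obstructions, for words without `s`, to being a subword of a word in `F`. -/
theorem exists_finite_obstructions_notMem [Finite A] (s : A) {F : Set (List A)} (hF : F.Finite) :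
    ∃ O : Set (List A), O.Finite ∧ (∀ u ∈ O, s ∉ u) ∧
      ∀ t, s ∉ t → ((∃ f ∈ F, t.Sublist f) ↔ ∀ u ∈ O, ¬ u.Sublist t) := by
  obtain ⟨O, hO, h⟩ := exists_finite_obstructions hF
  refine ⟨{u ∈ O | s ∉ u}, hO.subset fun u hu => hu.1, fun u hu => hu.2, fun t ht => ?_⟩
  rw [h]
  exact ⟨fun H u hu => H u hu.1, fun H u hu hut => H u ⟨hu, fun hs => ht (hut.subset hs)⟩ hut⟩

/-- The words all of whose gaps belong to `F`. -/
def separatedWords (s : A) (F : Set (List A)) : Set (List A) :=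
  {x | ∃ gs, (∀ g ∈ gs, g ∈ F) ∧ x = separated s gs}

/-- All gaps of a word are subwords of words in `F` iff this holds for the contents of all probes
that have as many separators as the word and are subwords of it. -/
theorem mem_separatedWords_downClosure_iff {s : A} {F O : Set (List A)} (hne : F.Nonempty)
    (hs : ∀ f ∈ F, s ∉ f) (hOs : ∀ u ∈ O, s ∉ u)
    (hO : ∀ t, s ∉ t → ((∃ f ∈ F, t.Sublist f) ↔ ∀ u ∈ O, ¬ u.Sublist t)) (x : List A) :
    x ∈ separatedWords s {t | ∃ f ∈ F, t.Sublist f} ↔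
      ∃ w, IsUnary s w ∧ w.Sublist x ∧ ∀ z, IsProbe s z → w.Sublist z → z.Sublist x →
        (∀ u ∈ O, ¬ u.Sublist z) ∧ StartsWith s z := by
  classical
  constructor
  · rintro ⟨gs, hgs, rfl⟩
    have hsgs : ∀ g ∈ gs, s ∉ g := fun g hg hsg => by
      obtain ⟨f, hf, hgf⟩ := hgs g hg
      exact hs f hf (hgf.subset hsg)
    refine ⟨List.replicate gs.length s, isUnary_iff.2 ⟨_, rfl⟩, replicate_sublist_separated le_rfl,
      fun z hz hwz hzx => ?_⟩
    obtain ⟨i, u, j, hu, rfl⟩ := exists_eq_probe hz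
    have hcount : gs.length = i + j := by
      have h₁ := hwz.count_le s
      have h₂ := hzx.count_le s
      rw [List.count_replicate_self, count_probe hu] at h₁
      rw [count_probe hu, count_separated hsgs] at h₂
      omega
    have hO_nil : ∀ o ∈ O, ¬ o.Sublist [] := by
      obtain ⟨f, hf⟩ := hne
      exact (hO [] (by simp)).1 ⟨f, hf, List.nil_sublist f⟩
    by_cases hune : u = []
    · subst hune
      refine ⟨fun o ho hoz => hO_nil o ho (sublist_of_sublist_probe (hOs o ho) hoz), fun c hc h => ?_⟩
      have := sublist_of_sublist_probe (by simpa using Ne.symm hc) h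
      simp at this
    · -- With no separator on the left, the content of the probe would have to embed into the
      -- part of `x` before its first separator, which is empty.
      have hi : ∃ i', i = i' + 1 := by
        cases i with
        | succ i => exact ⟨i, rfl⟩
        | zero =>
          have hz' : (u ++ separated s (List.replicate j [])).Sublist ([] ++ separated s gs) := by
            simpa [probe, separated_replicate_nil] using hzx
          have := (forall₂_sublist_of_separated_sublist (by simp) (by simp) hsgs
            (by simpa using hcount) hz').1
          exact absurd (List.sublist_nil.1 this) hune
      obtain ⟨i, rfl⟩ := hi
      rw [probe_succ_eq_separated] at hzx
      obtain ⟨g, hg, hug⟩ := exists_of_forall₂_of_mem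
        (forall₂_sublist_of_separated_sublist (h₀ := []) (g₀ := []) (by
          intro h hh
          simp only [List.mem_append, List.mem_replicate, List.mem_cons] at hh
          rcases hh with ⟨-, rfl⟩ | rfl | ⟨-, rfl⟩ <;> simp [hu]) (by simp) hsgs
          (by simp; omega) hzx).2 (a := u) (by simp)
      obtain ⟨f, hf, hgf⟩ := hgs g hg
      refine ⟨fun o ho hoz => (hO u hu).1 ⟨f, hf, hug.trans hgf⟩ o ho
        (sublist_of_sublist_probe (hOs o ho) hoz), fun c hc h => ?_⟩
      have := sublist_of_sublist_probe (by simpa using Ne.symm hc) h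
      exact sublist_probe_succ_of_mem (List.singleton_sublist.1 this)
  · rintro ⟨w, hw, hwx, h⟩
    obtain ⟨l, rfl⟩ := isUnary_iff.1 hw
    obtain ⟨g₀, gs, hg₀, hgs, rfl⟩ := exists_eq_append_separated s x
    have hl : l ≤ gs.length := by
      have := hwx.count_le s
      simpa [List.count_eq_zero.2 hg₀, count_separated hgs] using this
    have hg₀' : g₀ = [] := by
      rcases g₀ with _ | ⟨c, g₀⟩
      · rfl
      exfalso
      have hc : c ≠ s := by rintro rfl; simp at hg₀
      obtain ⟨-, hstart⟩ := h (probe s 0 [c] gs.length)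
        (not_sublist_probe (by simpa using Ne.symm hc) _ _)
        (by
          have := (List.replicate_sublist_replicate s).2 hl
          exact this.trans (by simp [probe]))
        (by
          simp only [probe, List.replicate_zero, List.nil_append, List.cons_append]
          refine List.Sublist.cons_cons c ?_
          exact (replicate_sublist_separated le_rfl).trans (List.sublist_append_right _ _))
      obtain ⟨k, hk⟩ := exists_succ_of_forall_sublist_probe (by simpa using Ne.symm hc) (by simp)
        hstart
      omega
    subst hg₀'
    refine ⟨gs, fun g hg => (hO g (hgs g hg)).2 fun o ho hog => ?_, rfl⟩
    obtain ⟨gs₁, gs₂, rfl⟩ := List.append_of_mem hg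
    refine (h (probe s (gs₁.length + 1) g gs₂.length) (not_sublist_probe (hgs g hg) _ _) ?_ ?_).1
      o ho (sublist_probe hog)
    · rw [List.replicate_sublist_iff, count_probe (hgs g hg)]
      simp at hl
      omega
    · simp only [probe, List.replicate_succ', List.append_assoc, List.nil_append, separated_append,
        separated_cons, List.cons_append]
      exact (replicate_sublist_separated le_rfl).append ((List.Sublist.refl g).append
        (replicate_sublist_separated le_rfl) |>.cons_cons s)

/-- The word `s V ⋯ s V` with `n` gaps has as subwords all probes that start with a separator, have
at most `n` separators, and whose content is a subword of `V`. -/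
theorem probe_sublist_separated_replicate {s : A} {V : List A} {O : Set (List A)} (hV : s ∉ V)
    (hO : ∀ t, s ∉ t → (t.Sublist V ↔ ∀ u ∈ O, ¬ u.Sublist t))
    {w y : List A} {n : ℕ} (hw : w = separated s (List.replicate n V))
    (hy : y = List.replicate (n + 1) s) :
    IsUnary s y ∧ ¬ y.Sublist w ∧ ∀ z, IsProbe s z → (∀ u ∈ O, ¬ u.Sublist z) → StartsWith s z →
      ¬ y.Sublist z → z.Sublist w := by
  classical
  subst hw hy
  have hVs : ∀ g ∈ List.replicate n V, s ∉ g := fun g hg => by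
    rwa [List.eq_of_mem_replicate hg]
  refine ⟨isUnary_iff.2 ⟨_, rfl⟩, fun h => ?_, fun z hz hOz hstart hyz => ?_⟩
  · have := h.count_le s
    rw [count_separated hVs] at this
    simp at this
  · obtain ⟨i, u, j, hu, rfl⟩ := exists_eq_probe hz
    rw [List.replicate_sublist_iff, count_probe hu] at hyz
    by_cases hune : u = []
    · subst hune
      simp only [probe, List.nil_append, List.replicate_append_replicate]
      exact replicate_sublist_separated (by simp; omega)
    · obtain ⟨i, rfl⟩ := exists_succ_of_forall_sublist_probe hu hune hstart
      have huV : u.Sublist V := (hO u hu).2 fun o ho hou => hOz o ho (sublist_probe hou)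
      obtain ⟨k, rfl⟩ : ∃ k, n = i + (1 + (j + k)) := ⟨n - i - 1 - j, by omega⟩
      simp only [probe, List.replicate_succ', List.replicate_add, separated_append, List.append_assoc,
        separated_cons, List.cons_append, List.nil_append]
      exact (replicate_sublist_separated (by simp)).append ((huV.append
        ((replicate_sublist_separated (by simp)).trans (List.sublist_append_left _ _))).cons_cons s)

/-- Conversely, a word that has as subwords all these probes, for a bound `y = s ⋯ s` on the number
of separators that exceeds its own, contains `V` in each gap. -/
theorem separated_replicate_sublist_of_probes {s : A} {V : List A} {O : Set (List A)} (hV : s ∉ V)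
    (hOs : ∀ u ∈ O, s ∉ u) (hO : ∀ t, s ∉ t → (t.Sublist V ↔ ∀ u ∈ O, ¬ u.Sublist t))
    [DecidableEq A] {w y : List A} (hy : IsUnary s y) (hyw : ¬ y.Sublist w)
    (h : ∀ z, IsProbe s z → (∀ u ∈ O, ¬ u.Sublist z) → StartsWith s z →
      ¬ y.Sublist z → z.Sublist w) :
    (separated s (List.replicate (w.count s) V)).Sublist w := by
  obtain ⟨l, rfl⟩ := isUnary_iff.1 hy
  obtain ⟨g₀, gs, hg₀, hgs, rfl⟩ := exists_eq_append_separated s w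
  have hcount : (g₀ ++ separated s gs).count s = gs.length := by
    simp [List.count_eq_zero.2 hg₀, count_separated hgs]
  rw [hcount]
  rw [List.replicate_sublist_iff, hcount] at hyw
  refine (separated_replicate_sublist_separated fun g hg => ?_).trans (List.sublist_append_right _ _)
  obtain ⟨gs₁, gs₂, rfl⟩ := List.append_of_mem hg
  simp only [List.length_append, List.length_cons] at hyw
  have hz := h (probe s (gs₁.length + 1) V gs₂.length) (not_sublist_probe hV _ _)
    (fun o ho hoz => (hO V hV).1 (List.Sublist.refl V) o ho (sublist_of_sublist_probe (hOs o ho) hoz))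
    (fun c hc hcz => by
      have := sublist_of_sublist_probe (by simpa using Ne.symm hc) hcz
      exact sublist_probe_succ_of_mem (List.singleton_sublist.1 this))
    (by rw [List.replicate_sublist_iff, count_probe hV]; omega)
  -- The separator before `V` is matched with the one before `g`, and the next one with the next.
  have hgs₁ : ∀ g ∈ gs₁, s ∉ g := fun g hg => hgs g (by simp [hg])
  have hgs₂ : ∀ g ∈ gs₂, s ∉ g := fun g hg => hgs g (by simp [hg])
  have hz' : (List.replicate gs₁.length s ++ s :: (V ++ separated s (List.replicate gs₂.length []))).Sublist
      ((g₀ ++ separated s gs₁) ++ s :: (g ++ separated s gs₂)) := by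
    simpa [probe, List.replicate_succ', separated_replicate_nil] using hz
  have h₂ := (sublist_of_append_cons_sublist hz'
    (by simp [List.count_eq_zero.2 hg₀, count_separated hgs₁])
    (by simp [List.count_eq_zero.2 hV, List.count_eq_zero.2 (hgs g hg), count_separated hgs₂,
      separated_replicate_nil])).2
  exact (forall₂_sublist_of_separated_sublist (by simp) (hgs g hg) hgs₂ (by simp) h₂).1

/-- Let the gaps of `x = s g₁ ⋯ s gₙ` belong to the antichain `F`, and let `z` be a word between
`x` and `s V ⋯ s V`, where `V = k W k`.  Two letters `k` in `z` are separated by `s` or enclose a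
word that contains a gap of `x`, and hence is not a subword of a proper subword of a word in `F`. -/
theorem not_enclosed_of_forall_mem [DecidableEq A] {s k : A} {F O : Set (List A)}
    {W : List A} (hsk : s ≠ k) (hs : ∀ f ∈ F, s ∉ f) (hk : ∀ f ∈ F, k ∉ f)
    (hanti : ∀ f ∈ F, ∀ g ∈ F, f.Sublist g → f = g) (hWs : s ∉ W) (hWk : k ∉ W)
    (hO : ∀ t, (∃ d ∈ {t | (∃ f ∈ F, t.Sublist f) ∧ t ∉ F}, t.Sublist d) ↔
      ∀ u ∈ O, ¬ u.Sublist t)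
    {gs : List (List A)} (hgs : ∀ g ∈ gs, g ∈ F) {z : List A} (hxz : (separated s gs).Sublist z)
    (hzw : z.Sublist (separated s (List.replicate gs.length (k :: (W ++ [k])))))
    (hkz : [k, k].Sublist z) (hOz : ∀ u ∈ O, ¬ (k :: (u ++ [k])).Sublist z) : False := by
  have hsgs : ∀ g ∈ gs, s ∉ g := fun g hg => hs g (hgs g hg)
  have hVs : ∀ g ∈ List.replicate gs.length (k :: (W ++ [k])), s ∉ g := fun g hg => by
    rw [List.eq_of_mem_replicate hg]
    simp [hWs, hsk]
  -- The two letters `k` and the word `b` between them.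
  obtain ⟨a, b, c, rfl⟩ : ∃ a b c, z = a ++ k :: (b ++ k :: c) := by
    obtain ⟨r₁, r₂, rfl, h₁, h₂⟩ := List.cons_sublist_iff.1 hkz
    obtain ⟨a, b₁, rfl⟩ := List.append_of_mem h₁
    obtain ⟨b₂, c, rfl⟩ := List.append_of_mem (List.singleton_sublist.1 h₂)
    exact ⟨a, b₁ ++ b₂, c, by simp⟩
  obtain ⟨d, ⟨⟨f, hf, hdf⟩, hdF⟩, hbd⟩ := (hO b).2 fun u hu hub => hOz u hu
    (((hub.append (List.Sublist.refl [k])).cons_cons k).trans (by simp))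
  have hbs : s ∉ b := fun h => hs f hf ((hbd.trans hdf).subset h)
  -- The gap of `z` in which the two letters lie.
  obtain ⟨a₀, as, ha₀, has, rfl⟩ := exists_eq_append_separated s a
  obtain ⟨c₀, cs, hc₀, hcs, rfl⟩ := exists_eq_append_separated s c
  have hcount : (a₀ ++ separated s as ++ k :: (b ++ k :: (c₀ ++ separated s cs))).count s =
      gs.length := by
    have h₁ := hxz.count_le s
    have h₂ := hzw.count_le s
    rw [count_separated hsgs] at h₁
    rw [count_separated hVs, List.length_replicate] at h₂
    omega
  simp only [List.count_append, List.count_cons, List.count_eq_zero.2 ha₀,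
    List.count_eq_zero.2 hc₀, List.count_eq_zero.2 hbs, count_separated has, count_separated hcs,
    beq_iff_eq, hsk.symm, if_false] at hcount
  rcases List.eq_nil_or_concat as with rfl | ⟨as, e, rfl⟩
  · have := (forall₂_sublist_of_separated_sublist (s := s) (h₀ := a₀ ++ k :: (b ++ k :: c₀))
      (g₀ := []) hcs (by simp) hVs (by simpa using hcount.symm) (by simpa using hzw)).1
    simp at this
  · simp only [List.concat_eq_append, List.mem_append, List.mem_singleton] at has hzw hxz hcount
    have he : s ∉ e := has e (.inr rfl)
    let h := e ++ k :: (b ++ k :: c₀)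
    have hhs : ∀ g ∈ as ++ h :: cs, s ∉ g := fun g hg => by
      rcases List.mem_append.1 hg with hg | hg
      · exact has g (.inl hg)
      · rcases List.mem_cons.1 hg with rfl | hg
        · simp [h, he, hsk, hbs, hc₀]
        · exact hcs g hg
    have hlen : (as ++ h :: cs).length = gs.length := by
      simp at hcount ⊢; omega
    obtain ⟨ha₀', hfor⟩ := forall₂_sublist_of_separated_sublist (s := s) (h₀ := a₀) (g₀ := [])
      (hs := as ++ h :: cs) hhs (by simp) hVs (by simpa using hlen.symm) (by simpa [h] using hzw)
    obtain rfl : a₀ = [] := List.sublist_nil.1 ha₀'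
    obtain ⟨V, hV, hhV⟩ := exists_of_forall₂_of_mem hfor (a := h) (by simp)
    obtain rfl := List.eq_of_mem_replicate hV
    -- The two letters are the outer letters of `V = k W k`.
    obtain ⟨he₀, hbc⟩ := sublist_of_append_cons_sublist (s := k) (p := e) (p' := [])
      (q' := W ++ [k]) hhV (by simp) (by
        simp only [List.count_append, List.count_cons_self, List.count_eq_zero.2 hWk,
          List.count_nil]
        omega)
    obtain ⟨-, hc₀'⟩ := sublist_of_append_cons_sublist (s := k) (p := b) (p' := W) (q' := [])
      hbc (by simp [List.count_eq_zero.2 hWk]) (by simp)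
    obtain rfl : e = [] := List.sublist_nil.1 he₀
    obtain rfl : c₀ = [] := List.sublist_nil.1 hc₀'
    have hfor' := (forall₂_sublist_of_separated_sublist (s := s) (h₀ := []) (g₀ := [])
      hsgs (by simp) hhs hlen (by simpa [h] using hxz)).2
    obtain ⟨g, hg, hgh⟩ := exists_of_forall₂_of_mem hfor'.flip (a := h) (by simp)
    have hgF := hgs g hg
    have hgb : g.Sublist b := by
      have hgh : g.Sublist ((List.replicate 1 k) ++ (b ++ List.replicate 1 k)) := by
        simpa [h, flip] using hgh
      exact sublist_of_sublist_probe (hk g hgF) hgh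
    obtain rfl := hanti g hgF f hf ((hgb.trans hbd).trans hdf)
    exact hdF ((hgb.trans hbd).antisymm hdf ▸ hgF)

/-- Conversely, a gap of `x` that is a proper subword of a word in `F` can be enclosed by
two letters `k` in a word between `x` and `s V ⋯ s V`. -/
theorem forall_mem_of_not_enclosed [DecidableEq A] {s k : A} {F O : Set (List A)}
    {W w : List A} (hsk : s ≠ k) (hk : ∀ f ∈ F, k ∉ f) (hW : ∀ f ∈ F, f.Sublist W)
    (hO : ∀ t, (∃ d ∈ {t | (∃ f ∈ F, t.Sublist f) ∧ t ∉ F}, t.Sublist d) ↔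
      ∀ u ∈ O, ¬ u.Sublist t)
    {gs : List (List A)} (hgs : ∀ g ∈ gs, ∃ f ∈ F, g.Sublist f)
    (hw : (separated s (List.replicate gs.length (k :: (W ++ [k])))).Sublist w)
    (h : ∀ z, ¬ ((separated s gs).Sublist z ∧ z.Sublist w ∧ [k, k].Sublist z ∧
      ∀ u ∈ O, ¬ (k :: (u ++ [k])).Sublist z)) :
    ∀ g ∈ gs, g ∈ F := by
  intro g hg
  by_contra hgF
  have hkgs : ∀ g ∈ gs, k ∉ g := fun g hg hkg => by
    obtain ⟨f, hf, hgf⟩ := hgs g hg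
    exact hk f hf (hgf.subset hkg)
  have hgV : ∀ g ∈ gs, g.Sublist (k :: (W ++ [k])) := fun g hg => by
    obtain ⟨f, hf, hgf⟩ := hgs g hg
    exact ((hgf.trans (hW f hf)).trans (List.sublist_append_left W [k])).cons k
  have hgW : g.Sublist W := by
    obtain ⟨f, hf, hgf⟩ := hgs g hg
    exact hgf.trans (hW f hf)
  obtain ⟨gs₁, gs₂, rfl⟩ := List.append_of_mem hg
  refine h (separated s (gs₁ ++ (k :: (g ++ [k])) :: gs₂)) ⟨?_, ?_, ?_, fun u hu huz => ?_⟩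
  · simp only [separated_append, separated_cons]
    refine (List.Sublist.refl _).append (List.Sublist.cons_cons s ?_)
    exact ((List.sublist_append_left g [k]).cons k).append (List.Sublist.refl _)
  · refine List.Sublist.trans ?_ hw
    have := separated_sublist_separated_replicate (s := s)
      (gs := gs₁ ++ (k :: (g ++ [k])) :: gs₂) (w := k :: (W ++ [k])) (fun g' hg' => by
        rcases List.mem_append.1 hg' with hg' | hg'
        · exact hgV g' (by simp [hg'])
        · rcases List.mem_cons.1 hg' with rfl | hg'
          · exact (hgW.append (List.Sublist.refl [k])).cons_cons k
          · exact hgV g' (by simp [hg']))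
    simpa using this
  · simp only [separated_append, separated_cons]
    refine List.Sublist.trans ?_ (List.sublist_append_right _ _)
    refine List.Sublist.cons s ?_
    refine List.Sublist.trans ?_ (List.sublist_append_left _ _)
    exact List.Sublist.cons_cons k (by simp)
  · have hk₁ : k ∉ separated s gs₁ := fun hm => by
      obtain ⟨g', hg', hkg'⟩ := (mem_separated hsk.symm).1 hm
      exact hkgs g' (by simp [hg']) hkg'
    have hk₂ : k ∉ separated s gs₂ := fun hm => by
      obtain ⟨g', hg', hkg'⟩ := (mem_separated hsk.symm).1 hm
      exact hkgs g' (by simp [hg']) hkg'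
    have huz' : ([] ++ k :: (u ++ k :: [])).Sublist
        ((separated s gs₁ ++ [s]) ++ k :: (g ++ k :: separated s gs₂)) := by
      simpa using huz
    obtain ⟨-, h₁⟩ := sublist_of_append_cons_sublist huz'
      (by simp [List.count_eq_zero.2 hk₁, hsk])
      (by simp [List.count_eq_zero.2 hk₂, List.count_eq_zero.2 (hkgs g hg)])
    obtain ⟨h₂, -⟩ := sublist_of_append_cons_sublist h₁
      (by simp [List.count_eq_zero.2 (hkgs g hg)]) (by simp [List.count_eq_zero.2 hk₂])
    exact (hO g).1 ⟨g, ⟨hgs g hg, hgF⟩, List.Sublist.refl g⟩ u hu h₂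

end GapLanguages

end SubwordLogic

namespace SubwordLogic

variable {A : Type}

/-- If `F` is a finite antichain of words without `s` and `k`, then the words `s g₁ s g₂ ⋯ s gₙ` with
gaps in `F` are definable. -/
theorem Sigma2Def.mem_separatedWords [Finite A] {s k : A} {F : Set (List A)} (hF : F.Finite)
    (hne : F.Nonempty) (hsk : s ≠ k) (hs : ∀ f ∈ F, s ∉ f) (hk : ∀ f ∈ F, k ∉ f)
    (hanti : ∀ f ∈ F, ∀ g ∈ F, f.Sublist g → f = g) {i j l : ℕ} (hi : i < 3) (hj : j < 3)
    (hl : l < 3) (hij : i ≠ j) (hil : i ≠ l) (hjl : j ≠ l) :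
    Sigma2Def fun v => v i ∈ separatedWords s F := by
  classical
  obtain ⟨O₁, hO₁, hO₁s, hO₁F⟩ := exists_finite_obstructions_notMem s hF
  have hdown : {t : List A | ∃ f ∈ F, t.Sublist f}.Finite := by
    have : {t : List A | ∃ f ∈ F, t.Sublist f} = ⋃ f ∈ F, {t | t ∈ f.sublists} := by
      ext t; simp
    rw [this]
    exact hF.biUnion fun f _ => List.finite_toSet _
  obtain ⟨O₂, hO₂, hO₂F⟩ := exists_finite_obstructions
    (hdown.subset (fun t ht => ht.1 : {t : List A | (∃ f ∈ F, t.Sublist f) ∧ t ∉ F} ⊆ _))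
  -- A word without `s` and `k` that contains all words of `F`.
  obtain ⟨W, hWs, hWk, hW⟩ : ∃ W : List A, s ∉ W ∧ k ∉ W ∧ ∀ f ∈ F, f.Sublist W := by
    refine ⟨hF.toFinset.toList.flatten, ?_, ?_, fun f hf => ?_⟩
    · simpa using hs
    · simpa using hk
    · exact List.sublist_flatten_of_mem (by simpa using hf)
  have hVs : s ∉ k :: (W ++ [k]) := by simp [hWs, hsk]
  obtain ⟨O₃, hO₃, hO₃s, hO₃V⟩ := exists_finite_obstructions_notMem s
    (Set.finite_singleton (k :: (W ++ [k])))
  simp only [Set.mem_singleton_iff, exists_eq_left] at hO₃V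
  -- All gaps of `x` are subwords of words in `F`.
  have hA : Sigma2Def fun v => v i ∈ separatedWords s {t | ∃ f ∈ F, t.Sublist f} := by
    refine (((((QFDef.isUnary s hj).and (.var_sublist_var hj hi)).pi1).and
      (((QFDef.isProbe s hl).imp ((QFDef.var_sublist_var hj hl).imp
        ((QFDef.var_sublist_var hl hi).imp ((QFDef.avoids hO₁ id hl).and
          (QFDef.startsWith s hl))))).pi1.all hl)).sigma2.ex hj).congr fun v => ?_
    rw [mem_separatedWords_downClosure_iff hne hs hO₁s hO₁F]
    simp [Function.update_of_ne, hij, hil, hjl, and_assoc]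
  -- The word `w` has as many separators as `x` and contains `V = k W k` in each gap, and no word
  -- between `x` and `w` encloses a proper subword of a word in `F` by two letters `k`.
  have hB : Sigma2Def fun v => ∃ w, (∀ z, IsUnary s z → (z.Sublist (v i) ↔ z.Sublist w)) ∧
      (∀ z, ¬ ((v i).Sublist z ∧ z.Sublist w ∧ [k, k].Sublist z ∧
        ∀ u ∈ O₂, ¬ (k :: (u ++ [k])).Sublist z)) ∧
      ∃ y, IsUnary s y ∧ ¬ y.Sublist w ∧ ∀ z, IsProbe s z → (∀ u ∈ O₃, ¬ u.Sublist z) →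
        StartsWith s z → ¬ y.Sublist z → z.Sublist w := by
    -- The bound variable `y` may reuse the variable that stands for `x` outside its scope.
    have h₁ := ((QFDef.isUnary s hl).imp ((QFDef.var_sublist_var hl hi).iff
      (QFDef.var_sublist_var hl hj))).pi1.all hl
    have h₂ := ((QFDef.var_sublist_var hi hl).and ((QFDef.var_sublist_var hl hj).and
      ((QFDef.const_sublist_var [k, k] hl).and
        (QFDef.avoids hO₂ (fun u => k :: (u ++ [k])) hl)))).not.pi1.all hl
    have h₃ := (((QFDef.isUnary s hi).and (QFDef.var_sublist_var hi hj).not).pi1.and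
      (((QFDef.isProbe s hl).imp ((QFDef.avoids hO₃ id hl).imp ((QFDef.startsWith s hl).imp
        ((QFDef.var_sublist_var hi hl).not.imp (QFDef.var_sublist_var hl hj))))).pi1.all
          hl)).sigma2.ex hi
    refine ((h₁.sigma2.and (h₂.sigma2.and h₃)).ex hj).congr fun v => ?_
    simp [Function.update_of_ne, hij, hil, hjl, hij.symm, and_assoc]
  refine (hA.and hB).congr fun v => ?_
  generalize v i = x
  constructor
  · rintro ⟨gs, hgs, rfl⟩
    have hsgs : ∀ g ∈ gs, s ∉ g := fun g hg => hs g (hgs g hg)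
    refine ⟨⟨gs, fun g hg => ⟨g, hgs g hg, List.Sublist.refl g⟩, rfl⟩,
      separated s (List.replicate gs.length (k :: (W ++ [k]))), fun z hz => ?_,
      fun z hz => not_enclosed_of_forall_mem hsk hs hk hanti hWs hWk hO₂F hgs hz.1 hz.2.1
        hz.2.2.1 hz.2.2.2, _, probe_sublist_separated_replicate hVs hO₃V rfl rfl⟩
    obtain ⟨n, rfl⟩ := isUnary_iff.1 hz
    rw [List.replicate_sublist_iff, List.replicate_sublist_iff, count_separated hsgs,
      count_separated fun g hg => by rwa [List.eq_of_mem_replicate hg], List.length_replicate]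
  · rintro ⟨⟨gs, hgs, rfl⟩, w, hcount, h, y, hy, hyw, hz⟩
    have hsgs : ∀ g ∈ gs, s ∉ g := fun g hg hsg => by
      obtain ⟨f, hf, hgf⟩ := hgs g hg
      exact hs f hf (hgf.subset hsg)
    have hcount' : w.count s = gs.length := by
      refine le_antisymm ?_ ?_
      · have := (hcount (List.replicate (w.count s) s) (isUnary_iff.2 ⟨_, rfl⟩)).2
          (List.replicate_sublist_iff.2 le_rfl)
        rwa [List.replicate_sublist_iff, count_separated hsgs] at this
      · have := (hcount (List.replicate gs.length s) (isUnary_iff.2 ⟨_, rfl⟩)).1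
          (List.replicate_sublist_iff.2 (count_separated hsgs).ge)
        rwa [List.replicate_sublist_iff] at this
    have hVw := separated_replicate_sublist_of_probes hVs hO₃s hO₃V hy hyw hz
    rw [hcount'] at hVw
    exact ⟨gs, forall_mem_of_not_enclosed hsk hk hW hO₂F hgs hVw h, rfl⟩

/-! ### Encoding sequences -/

/-- The letters of the words that represent sequences of elements of `R`, each of which
contributes a word over `G`: a separator, an auxiliary letter, the elements of `R`, and
those of `G`. -/
inductive Letter (R G : Type) : Type where
  | sep
  | aux
  | item (r : R)
  | sym (g : G)

namespace Letter

variable {R G : Type}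

instance [Finite R] [Finite G] : Finite (Letter R G) := by
  refine Finite.of_injective (β := Option (Option (R ⊕ G)))
    (fun | .sep => none | .aux => some none
         | .item r => some (some (.inl r)) | .sym g => some (some (.inr g))) ?_
  intro x y h
  cases x <;> cases y <;> simp_all

/-- The gap that represents an element `r` of `R` contributing the word `p r`. -/
def gap (p : R → List G) (r : R) : List (Letter R G) := item r :: (p r).map sym

/-- The word that represents a sequence of elements of `R`. -/
def encode (p : R → List G) (rs : List R) : List (Letter R G) := separated sep (rs.map (gap p))

theorem item_injective : Function.Injective (item : R → Letter R G) := fun _ _ h => by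
  injection h

theorem sym_injective : Function.Injective (sym : G → Letter R G) := fun _ _ h => by
  injection h

/-- The letters from `R`. -/
def isItem : Letter R G → Bool
  | item _ => true
  | _ => false

/-- The letters from `G`. -/
def isSym : Letter R G → Bool
  | sym _ => true
  | _ => false

theorem filter_isItem_map_sym (l : List G) : (l.map (sym (R := R))).filter isItem = [] := by
  simp [isItem]

theorem filter_isItem_encode (p : R → List G) (rs : List R) :
    (encode p rs).filter isItem = rs.map item := by
  induction rs with
  | nil => rfl
  | cons r rs ih =>
    have ih' : (separated sep (rs.map (gap p))).filter isItem = rs.map item := ih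
    rw [encode, List.map_cons, separated_cons, gap, List.filter_cons_of_neg (by simp [isItem]),
      List.cons_append, List.filter_cons_of_pos rfl, List.filter_append,
      filter_isItem_map_sym, ih']
    rfl

theorem filter_isSym_encode (p : R → List G) (rs : List R) :
    (encode p rs).filter isSym = (rs.flatMap p).map sym := by
  have hsym : ∀ l : List G, (l.map (sym (R := R))).filter isSym = l.map sym := fun l => by
    simp [isSym]
  induction rs with
  | nil => rfl
  | cons r rs ih =>
    have ih' : (separated sep (rs.map (gap p))).filter isSym = (rs.flatMap p).map sym := ih
    rw [encode, List.map_cons, separated_cons, gap, List.filter_cons_of_neg (by simp [isSym]),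
      List.cons_append, List.filter_cons_of_neg (by simp [isSym]), List.filter_append, hsym, ih',
      List.flatMap_cons, List.map_append]

theorem map_item_sublist_encode {p : R → List G} {rs us : List R} :
    (us.map item).Sublist (encode p rs) ↔ us.Sublist rs := by
  constructor
  · intro h
    have := h.filter isItem
    rw [filter_isItem_encode, List.filter_eq_self.2 (by simp [isItem])] at this
    obtain ⟨us', h, he⟩ := List.sublist_map_iff.1 this
    rwa [List.map_injective_iff.2 item_injective he]
  · intro h
    have := h.map (item (G := G))
    rw [← filter_isItem_encode p rs] at this
    exact List.Sublist.trans this List.filter_sublist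

theorem mem_separatedWords_iff {p : R → List G} {x : List (Letter R G)} :
    x ∈ separatedWords sep (Set.range (gap p)) ↔ ∃ rs, x = encode p rs := by
  constructor
  · rintro ⟨gs, hgs, rfl⟩
    obtain ⟨rs, rfl⟩ : ∃ rs : List R, gs = rs.map (gap p) := by
      induction gs with
      | nil => exact ⟨[], rfl⟩
      | cons g gs ih =>
        obtain ⟨rs, rfl⟩ := ih fun g hg => hgs g (List.mem_cons_of_mem _ hg)
        obtain ⟨r, rfl⟩ := hgs g List.mem_cons_self
        exact ⟨r :: rs, rfl⟩
    exact ⟨rs, rfl⟩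
  · rintro ⟨rs, rfl⟩
    exact ⟨_, by simp, rfl⟩

theorem sigma2Def_mem_range_encode [Finite R] [Nonempty R] [Finite G] (p : R → List G) {i j l : ℕ}
    (hi : i < 3) (hj : j < 3) (hl : l < 3) (hij : i ≠ j) (hil : i ≠ l) (hjl : j ≠ l) :
    Sigma2Def fun v : ℕ → List (Letter R G) => ∃ rs, v i = encode p rs := by
  refine (Sigma2Def.mem_separatedWords (s := sep) (k := aux) (Set.finite_range (gap p))
    (Set.range_nonempty _) (by simp) ?_ ?_ ?_ hi hj hl hij hil hjl).congr fun v =>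
      mem_separatedWords_iff.symm
  · rintro _ ⟨r, rfl⟩; simp [gap]
  · rintro _ ⟨r, rfl⟩; simp [gap]
  · rintro _ ⟨r, rfl⟩ _ ⟨r', rfl⟩ h
    have h' := h.filter isItem
    have hr : r = r' := by
      rw [gap, gap, List.filter_cons_of_pos rfl, List.filter_cons_of_pos rfl,
        filter_isItem_map_sym, filter_isItem_map_sym] at h'
      simpa using h'
    rw [hr]

/-- Two sequences and the two words that they contribute agree iff the encodings have the same
subwords over `R` and over `G`. -/
theorem forall_sublist_iff {p c : R → List G} {rs rs' : List R} :
    (∀ z, ((∀ a, isItem a = false → ¬ [a].Sublist z) ∨ (∀ a, isSym a = false → ¬ [a].Sublist z)) →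
      (z.Sublist (encode p rs) ↔ z.Sublist (encode c rs'))) ↔
    rs = rs' ∧ rs.flatMap p = rs'.flatMap c := by
  have key : ∀ (f : Letter R G → Bool) (x y : List (Letter R G)),
      (∀ z, (∀ a, f a = false → ¬ [a].Sublist z) → (z.Sublist x ↔ z.Sublist y)) ↔
        x.filter f = y.filter f := by
    intro f x y
    have hf : ∀ z : List (Letter R G), (∀ a, f a = false → ¬ [a].Sublist z) ↔ z.filter f = z := by
      intro z
      rw [List.filter_eq_self]
      simp only [List.singleton_sublist]
      exact forall_congr' fun a => by cases f a <;> simp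
    have hz : ∀ {x z : List (Letter R G)}, z.filter f = z →
        (z.Sublist x ↔ z.Sublist (x.filter f)) := fun {x z} hz =>
      ⟨fun h => hz ▸ h.filter f, fun h => h.trans List.filter_sublist⟩
    simp only [hf]
    constructor
    · intro h
      have hx := (h (x.filter f) (by simp)).1 List.filter_sublist
      have hy := (h (y.filter f) (by simp)).2 List.filter_sublist
      exact ((hz (by simp)).1 hx).antisymm ((hz (by simp)).1 hy)
    · intro h z hzf
      rw [hz hzf, h, ← hz hzf]
  simp only [or_imp, forall_and, key, filter_isItem_encode, filter_isSym_encode,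
    (List.map_injective_iff.2 item_injective).eq_iff, (List.map_injective_iff.2 sym_injective).eq_iff]

end Letter

open Letter in
/-- The encodings of the sequences over `R` that contribute the same word under `p` and under `c`
are definable, as are further conditions on subsequences of length at most two. -/
theorem sigma2Def_exists_encode {R G : Type} [Finite R] [Nonempty R] [Finite G] (p c : R → List G)
    (Q : R → R → Prop) (r₁ r₂ r₃ : R) :
    Sigma2Def fun v : ℕ → List (Letter R G) => ∃ rs, v 0 = encode p rs ∧
      rs.Pairwise Q ∧ r₁ ∈ rs ∧ r₂ ∈ rs ∧ r₃ ∈ rs ∧ rs.flatMap p = rs.flatMap c := by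
  have hproj : ∀ f : Letter R G → Bool, QFDef fun v : ℕ → List (Letter R G) =>
      ∀ a, f a = false → ¬ [a].Sublist (v 2) := fun f =>
    QFDef.forall_mem (s := {a | f a = false}) (Set.toFinite _) fun a =>
      (QFDef.const_sublist_var [a] (by norm_num)).not
  have h₁ := ((((hproj isItem).or (hproj isSym)).imp
    ((QFDef.var_sublist_var (i := 2) (j := 0) (by norm_num) (by norm_num)).iff
      (QFDef.var_sublist_var (i := 2) (j := 1) (by norm_num) (by norm_num)))).pi1.all
        (i := 2) (by norm_num)).sigma2
  have h₂ := ((sigma2Def_mem_range_encode c (i := 1) (j := 0) (l := 2) (by norm_num) (by norm_num)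
    (by norm_num) (by norm_num) (by norm_num) (by norm_num)).and h₁).ex (i := 1) (by norm_num)
  have h₃ : QFDef fun v : ℕ → List (Letter R G) =>
      ∀ q ∈ {q : R × R | ¬ Q q.1 q.2}, ¬ ([q.1, q.2].map item).Sublist (v 0) :=
    QFDef.forall_mem (Set.toFinite _) fun q => (QFDef.const_sublist_var _ (by norm_num)).not
  have h₄ : ∀ r : R, QFDef fun v : ℕ → List (Letter R G) => ([r].map item).Sublist (v 0) :=
    fun r => QFDef.const_sublist_var _ (by norm_num)
  refine ((sigma2Def_mem_range_encode p (i := 0) (j := 1) (l := 2) (by norm_num) (by norm_num)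
    (by norm_num) (by norm_num) (by norm_num) (by norm_num)).and
      ((h₃.and ((h₄ r₁).and ((h₄ r₂).and (h₄ r₃)))).pi1.sigma2.and h₂)).congr fun v => ?_
  simp only [Function.update_self, ne_eq, not_false_eq_true,
    Function.update_of_ne, OfNat.zero_ne_ofNat, OfNat.one_ne_ofNat, zero_ne_one]
  have hpair : ∀ rs : List R, rs.Pairwise Q ↔
      ∀ q ∈ {q : R × R | ¬ Q q.1 q.2}, ¬ ([q.1, q.2].map item).Sublist (encode p rs) := fun rs => by
    simp only [map_item_sublist_encode, List.pairwise_iff_forall_sublist, Set.mem_ofPred_eq,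
      Prod.forall]
    exact ⟨fun h a b hQ hab => hQ (h hab), fun h a b hab => by_contra fun hQ => h a b hQ hab⟩
  constructor
  · rintro ⟨rs, h, hQ, h₁, h₂, h₃, heq⟩
    rw [h]
    refine ⟨⟨rs, rfl⟩, ⟨(hpair rs).1 hQ, map_item_sublist_encode.2 (by simpa),
      map_item_sublist_encode.2 (by simpa), map_item_sublist_encode.2 (by simpa)⟩,
      encode c rs, ⟨rs, rfl⟩, forall_sublist_iff.2 ⟨rfl, heq⟩⟩
  · rintro ⟨⟨rs, h⟩, hc, w, ⟨rs', rfl⟩, hz⟩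
    rw [h] at hc hz
    obtain ⟨rfl, heq⟩ := forall_sublist_iff.1 hz
    simp only [map_item_sublist_encode, List.singleton_sublist] at hc
    exact ⟨rs, h, (hpair rs).2 (by simpa only [map_item_sublist_encode] using hc.1), hc.2.1,
      hc.2.2.1, hc.2.2.2, heq⟩

end SubwordLogic

namespace SubwordLogic

/-! ### The reduction -/

/-- Renaming the letters of the constants in a term. -/
def Term.map {A B : Type} (e : A → B) : Term A → Term B
  | .var x => .var x
  | .const w => .const (w.map e)

namespace Formula

variable {A B : Type}

/-- Renaming the letters of the constants in a formula. -/
def map (e : A → B) : Formula A → Formula B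
  | sub s t => sub (s.map e) (t.map e)
  | neg φ => neg (φ.map e)
  | and φ ψ => and (φ.map e) (ψ.map e)
  | ex x φ => ex x (φ.map e)
  | all x φ => all x (φ.map e)

theorem vars_map (e : A → B) (φ : Formula A) : (φ.map e).vars = φ.vars := by
  have ht : ∀ t : Term A, (t.map e).vars = t.vars := fun t => by cases t <;> rfl
  induction φ <;> simp_all [map, vars]

theorem isSigma_isPi_map (e : A → B) (φ : Formula A) :
    ∀ n, ((φ.map e).IsSigma n ↔ φ.IsSigma n) ∧ ((φ.map e).IsPi n ↔ φ.IsPi n) := by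
  induction φ <;> simp_all [map, IsSigma, IsPi]

theorem sat_map (e : A ≃ B) (φ : Formula A) (v : ℕ → List B) :
    (φ.map e).Sat v ↔ φ.Sat fun i => (v i).map e.symm := by
  have hupd : ∀ (v : ℕ → List B) (x : ℕ) (w : List B),
      (fun i => (Function.update v x w i).map e.symm) =
        Function.update (fun i => (v i).map e.symm) x (w.map e.symm) := fun v x w => by
    funext i
    by_cases h : i = x
    · subst h; simp
    · simp [h]
  have hsurj : ∀ p : List A → Prop, (∀ w, p w) ↔ ∀ w : List B, p (w.map e.symm) := fun p =>
    (List.map_surjective_iff.2 e.symm.surjective).forall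
  have hsurj' : ∀ p : List A → Prop, (∃ w, p w) ↔ ∃ w : List B, p (w.map e.symm) := fun p =>
    (List.map_surjective_iff.2 e.symm.surjective).exists
  induction φ generalizing v with
  | sub s t =>
    have ht : ∀ t : Term A, (t.map e).eval v =
        (t.eval fun i => (v i).map e.symm).map e := fun t => by
      cases t <;> simp [Term.map, Term.eval]
    have hsub : ∀ x y : List A, (x.map e).Sublist (y.map e) ↔ x.Sublist y := fun x y =>
      ⟨fun h => by simpa using h.map e.symm, fun h => h.map e⟩
    simp only [map, Sat, ht, hsub]
  | neg φ ih => simp only [map, Sat, ih]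
  | and φ ψ ih₁ ih₂ => simp only [map, Sat, ih₁, ih₂]
  | ex x φ ih => simp only [map, Sat, ih, hupd, hsurj']
  | all x φ ih => simp only [map, Sat, ih, hupd, hsurj]

/-- The sentence that asserts the existence of a word with the property defined by `φ` in which the
letter `a` occurs exactly `n` times. -/
def existsWithCount (φ : Formula A) (a : A) (n : ℕ) : Formula A :=
  ex 0 (ex 1 (ex 2 (and φ (and (sub (.const (List.replicate n a)) (.var 0))
    (neg (sub (.const (List.replicate (n + 1) a)) (.var 0)))))))

/-- The quantifiers over `1` and `2` bind nothing when `φ` expresses a property of the variable `0`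
alone; they make the formula a sentence in any case. -/
theorem existsWithCount_mem_fragment {φ : Formula A} (hφ : φ.IsSigma 2)
    (hvars : φ.vars ⊆ Finset.range 3) (a : A) (n : ℕ) :
    (φ.existsWithCount a n).IsSentence ∧ (φ.existsWithCount a n).IsSigma 2 ∧
      (φ.existsWithCount a n).IsFO 3 := by
  have hfree : ∀ φ : Formula A, φ.freeVars ⊆ φ.vars := fun φ => by
    induction φ with
    | sub s t => exact Finset.Subset.refl _
    | neg φ ih => exact ih
    | and φ ψ ih₁ ih₂ => exact Finset.union_subset_union ih₁ ih₂
    | ex x φ ih =>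
      exact ((Finset.erase_subset _ _).trans ih).trans (Finset.subset_insert _ _)
    | all x φ ih =>
      exact ((Finset.erase_subset _ _).trans ih).trans (Finset.subset_insert _ _)
  have hv : (φ.existsWithCount a n).vars ⊆ Finset.range 3 := by
    simp only [existsWithCount, vars, Term.vars]
    simp [Finset.insert_subset_iff, hvars]
  refine ⟨?_, by simp [existsWithCount, IsSigma, IsPi, hφ], ?_⟩
  · refine Finset.eq_empty_iff_forall_notMem.2 fun x hx => ?_
    have := Finset.mem_range.1 (hv (hfree _ hx))
    simp only [existsWithCount, freeVars, Finset.mem_erase] at hx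
    omega
  · exact (Finset.card_le_card hv).trans (Finset.card_range 3).le

theorem isTrue_existsWithCount_iff {φ : Formula A} {P : List A → Prop}
    (hφ : ∀ v, φ.Sat v ↔ P (v 0)) (a : A) (n : ℕ) :
    (φ.existsWithCount a n).IsTrue ↔ ∃ x, P x ∧ (List.replicate n a).Sublist x ∧
      ¬ (List.replicate (n + 1) a).Sublist x := by
  simp [existsWithCount, IsTrue, Sat, hφ, Term.eval, Function.update_of_ne]

/-- The number `n` enters the sentence only through the constants `aⁿ` and `aⁿ⁺¹`. -/
theorem primrec_code_existsWithCount {k : ℕ} (φ : Formula (Fin k)) (a : Fin k) :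
    Primrec fun n => Instance.code ⟨k, φ.existsWithCount a n⟩ := by
  have hrep : Primrec fun n => Encodable.encode (List.replicate n a.1) := by
    refine Primrec.encode.comp ((Primrec.nat_rec₁ ([] : List ℕ) (f := fun _ l => a.1 :: l)
      (Primrec.list_cons.comp (Primrec.const a.1) Primrec.snd)).of_eq fun n => ?_)
    induction n with
    | zero => rfl
    | succ n ih => rw [List.replicate_succ, ← ih]
  have hpair : ∀ (c : ℕ) {f : ℕ → ℕ}, Primrec f → Primrec fun n => Nat.pair c (f n) :=
    fun c _ hf => Primrec₂.natPair.comp (Primrec.const c) hf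
  have hsub : ∀ {f : ℕ → ℕ}, Primrec f →
      Primrec fun n => Nat.pair 0 (Nat.pair (Nat.pair 1 (f n)) (Nat.pair 0 0)) := fun hf =>
    hpair 0 (Primrec₂.natPair.comp (hpair 1 hf) (Primrec.const _))
  simp only [Instance.code, existsWithCount, code, Term.code, List.map_replicate]
  exact hpair _ (hpair _ (hpair _ (hpair _ (hpair _ (hpair _ (hpair _ (hpair _ (hpair _
    (hpair _ (Primrec₂.natPair.comp (hsub hrep)
      (hpair _ (hsub (hrep.comp Primrec.succ)))))))))))))

end Formula

theorem Sigma2Def.map {A B : Type} {P : (ℕ → List A) → Prop} (h : Sigma2Def P) (e : A ≃ B) :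
    Sigma2Def fun v : ℕ → List B => P fun i => (v i).map e.symm := by
  obtain ⟨φ, h₁, h₂, h₃⟩ := h
  exact ⟨φ.map e, ((Formula.isSigma_isPi_map e φ 2).1).2 h₁, by rwa [Formula.vars_map],
    fun v => (Formula.sat_map e φ v).trans (h₃ _)⟩

open Turing Relation in
/-- There is a fixed alphabet with `Σ₂` sentences in three variables that express the halting of
a Turing machine with an undecidable halting problem. -/
theorem exists_instances_not_computablePred :
    ∃ (k : ℕ) (φ : Formula (Fin k)) (a : Fin k), φ.IsSigma 2 ∧ φ.vars ⊆ Finset.range 3 ∧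
      ¬ ComputablePred fun n => (φ.existsWithCount a n).IsTrue := by
  obtain ⟨Γ, Λ, _, _, _, M, S, a, b, hfin, hS, hM⟩ := TM0.exists_not_computablePred_halts
  have : Finite S := hfin
  let P := TMRewriting.rules M S
  have : Finite P := TMRewriting.finite_rules M S
  have : Nonempty (Move P) := ⟨.start⟩
  let u : List (TMRewriting.TapeSym S Γ) := [.left, .state ⟨default, hS.1⟩, .tape a]
  let p := Move.produced (P := P) u (.tape b) [.right]
  let c := Move.consumed (P := P) [.left, .halted, .right]
  let e := Finite.equivFin (Letter (Move P) (Option (TMRewriting.TapeSym S Γ)))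
  obtain ⟨φ, hφ, hvars, hsat⟩ :=
    (sigma2Def_exists_encode p c Move.Precedes Move.start Move.go Move.finish).map e
  refine ⟨_, φ, e (.item .load), hφ, hvars, fun h => hM (h.of_eq fun n => ?_)⟩
  rw [TMRewriting.eval_dom_iff hS, Formula.isTrue_existsWithCount_iff
    (P := fun x => ∃ rs, x.map e.symm = Letter.encode p rs ∧ rs.Pairwise Move.Precedes ∧
      Move.start ∈ rs ∧ Move.go ∈ rs ∧ Move.finish ∈ rs ∧ rs.flatMap p = rs.flatMap c) hsat]
  have hrep : ∀ (n : ℕ) (rs : List (Move P)),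
      (List.replicate n (e (.item .load))).Sublist ((Letter.encode p rs).map e) ↔
        (List.replicate n .load).Sublist rs := fun n rs => by
    rw [← Letter.map_item_sublist_encode (p := p), ← List.map_replicate, List.map_replicate]
    exact ⟨fun h => by simpa using h.map e.symm, fun h => by simpa using h.map e⟩
  have hx : ∀ (x : List (Fin _)) (y : List (Letter _ _)), x.map e.symm = y ↔ x = y.map e :=
    fun x y => ⟨fun h => by simp [← h], fun h => by simp [h]⟩
  have := Move.exists_transcript_iff (P := P) (u := u) (v := [.right]) (b := .tape b)
    (wf := [.left, .halted, .right]) n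
  simp only [List.map_replicate, u, List.cons_append, List.nil_append] at this ⊢
  rw [← this]
  constructor
  · rintro ⟨x, ⟨rs, hxrs, h₁, h₂, h₃, h₄, heq⟩, h₅, h₆⟩
    rw [hx] at hxrs
    subst hxrs
    exact ⟨rs, h₁, h₂, h₃, h₄, (hrep _ _).1 h₅, fun h => h₆ ((hrep _ _).2 h), heq⟩
  · rintro ⟨rs, h₁, h₂, h₃, h₄, h₅, h₆, heq⟩
    exact ⟨(Letter.encode p rs).map e, ⟨rs, (hx _ _).2 rfl, h₁, h₂, h₃, h₄, heq⟩,
      (hrep _ _).2 h₅, fun h => h₆ ((hrep _ _).1 h)⟩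

/-- A decision procedure for a set of instances decides every computable family in the set. -/
theorem TruthProblemDecidableOn.computablePred {S : Set Instance} (hS : TruthProblemDecidableOn S)
    {I : ℕ → Instance} (hI : ∀ n, I n ∈ S) (hcode : Computable fun n => (I n).code) :
    ComputablePred fun n => (I n).formula.IsTrue := by
  classical
  obtain ⟨d, hd, h⟩ := hS
  refine ⟨fun _ => Classical.propDecidable _, (hd.comp hcode).of_eq_tot fun n => ?_⟩
  obtain ⟨b, hb, hbtrue⟩ := h (I n) (hI n)
  convert hb
  rw [Bool.eq_iff_iff, hbtrue, decide_eq_true_iff]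

end SubwordLogic

theorem mainTheorem1 :
    ¬ SubwordLogic.TruthProblemDecidableOn {I | I.formula.IsSentence} ∧
    ¬ SubwordLogic.TruthProblemDecidableOn
        {I | I.formula.IsSentence ∧ I.formula.IsSigma 2 ∧ I.formula.IsFO 3} := by
  obtain ⟨k, φ, a, hφ, hvars, hno⟩ := SubwordLogic.exists_instances_not_computablePred
  have hfrag := SubwordLogic.Formula.existsWithCount_mem_fragment hφ hvars a
  have hcode := (SubwordLogic.Formula.primrec_code_existsWithCount φ a).to_comp
  exact ⟨fun h => hno (h.computablePred (I := fun n => ⟨k, φ.existsWithCount a n⟩)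
      (fun n => (hfrag n).1) hcode),
    fun h => hno (h.computablePred (I := fun n => ⟨k, φ.existsWithCount a n⟩) hfrag hcode)⟩
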